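/- **Setting.** For $n\ge 1$ observe $y_i^n=\bar f_i^n+\xi_i^n$, $i=0,\dots,n-1$, where $\bar f_i^n=n\int_{[i/n,(i+1)/n)}f(x)\,dx$ and $\xi_0^n,\dots,\xi_{n-1}^n$ are independent (not necessarily identically distributed) centered random variables with $\mathbb E\,e^{u\xi_i^n}\le e^{u^2\sigma^2/2}$ for all $u\in\mathbb R$, with $\sigma>0$ known. Let $\mathcal S$ be the set of step functions $f=\sum_{i=0}^{k}c_i\mathbf 1_{[\tau_i,\tau_{i+1})}$ on $[0,1)$ with $k\in\mathbb N_0$, $0=\tau_0<\dots<\tau_{k+1}=1$ and $c_i\ne c_{i+1}$; write $\#J(f)=k$ for the number of jumps. For $L>0$ let $\mathcal S_L(k)=\{f\in\mathcal S:\#J(f)\le k,\ \|f\|_{L^\infty}\le L\}$. Let $\mathcal S^{(n)}\subset\mathcal S$ be the step functions whose jumps all lie on the sampling grid $\{i/n\}$. *Normal systems.* For $c>1$, a system $\mathcal I=\mathcal I_n$ of intervals $[u,v)\subseteq[0,1)$ is $c$-normal if (a) every interval $I\subseteq[0,1)$ with $|I|>c/n$ contains some $\tilde I\in\mathcal I$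 with $|\tilde I|\ge c^{-1}|I|$; (b) the end-points of all members of $\mathcal I$ lie in $\{i/n: 0\le i\le n\}$; (c) $[i/n,(i+1)/n)\in\mathcal I$ for $0\le i<n$. *Multiscale change-point segmentation estimators.* Given $c$-normal systems $\mathcal I_n$, real scale penalties $s_I$ (deterministic or random, possibly depending on the data and on the candidate function) with $\sup_{I\in\mathcal I_n}|s_I|\le\delta\sqrt{\log n}$ almost surely, uniformly over data vectors and candidates, for a constant $\delta>0$, and a threshold $\eta$, such an estimator $\hat f_n$ is any (almost sure) solution of $$\min_{g\in\mathcal S^{(n)}}\#J(g)\quad\text{subject to}\quad \sup_{I\in\mathcal I_n,\ g\equiv c_I\text{ on }I}\Bigl\{\frac1{\sqrt{n|I|}}\Bigl|\sum_{i/n\in I}(y_i^n-c_I)\Bigr|-s_I\Bigr\}\le\eta .$$ **Theorem.** Let $0<p,r<\infty$, $L>0$, and let $k_n\in\mathbb N_0$ with $k_n=o(n)$. (i) Let $\hat f_n$ be a multiscale change-point segmentation estimator with constants $c,\delta$ and threshold $\eta=a\sqrt{\log n}$, where $a>\delta+\sigma\sqrt{2r+4}$. Then $$\limsup_{n\to\infty}\frac1{\sqrt{\log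 n}}\Bigl(\frac n{2k_n+1}\Bigr)^{\min\{1/2,1/p\}}\sup_{f\in\mathcal S_L(k_n)}\bigl(\mathbb E\|\hat f_n-f\|_{L^p}^r\bigr)^{1/r}<\infty,$$ and, almost surely, $$\limsup_{n\to\infty}\frac1{\sqrt{\log n}}\Bigl(\frac n{2k_n+1}\Bigr)^{\min\{1/2,1/p\}}\sup_{f\in\mathcal S_L(k_n)}\|\hat f_n-f\|_{L^p}<\infty .$$ (ii) Suppose that each $\xi_i^n$ has a Lebesgue density $\varphi_{i,n}$ and that for some constants $\sigma_0,z_0>0$ $$\int\varphi_{i,n}(x)\log\frac{\varphi_{i,n}(x)}{\varphi_{i,n}(x+z)}\,dx\le\frac{z^2}{\sigma_0^2}\qquad\text{for all } i,n \text{ and all } |z|\le z_0 .$$ If $p>2$, suppose in addition that $k_n\ge1$ for all sufficiently large $n$. Then $$\liminf_{n\to\infty}\Bigl(\frac n{2k_n+1}\Bigr)^{\min\{1/2,1/p\}}\inf_{\hat g_n}\sup_{f\in\mathcal S_L(k_n)}\bigl(\mathbb E\|\hat g_n-f\|_{L^p}^r\bigr)^{1/r}>0,$$ where the infimum is over all estimators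 $\hat g_n$, i.e. all measurable functions of the data $y^n$. -/

import Mathlib

open MeasureTheory ProbabilityTheory Filter Asymptotics
open scoped ENNReal Topology

namespace Segmentation

/-- `IsStep k f`: on `[0,1)` the function `f` equals `∑ i ≤ k, c i • 1_{[τ i, τ (i+1))}` with
`0 = τ 0 < τ 1 < ⋯ < τ (k+1) = 1` and consecutive values distinct. So `f` is a right-continuous step
function with exactly `k` jumps. Values outside `[0,1)` play no role. -/
def IsStep (k : ℕ) (f : ℝ → ℝ) : Prop :=
  ∃ (τ : ℕ → ℝ) (c : ℕ → ℝ),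
    τ 0 = 0 ∧ τ (k + 1) = 1 ∧ (∀ i ≤ k, τ i < τ (i + 1)) ∧ (∀ i < k, c i ≠ c (i + 1)) ∧
      ∀ i ≤ k, ∀ x ∈ Set.Ico (τ i) (τ (i + 1)), f x = c i

/-- The step functions on `[0,1)` with at most `k` jumps that are bounded by `L`. -/
def boundedSteps (L : ℝ) (k : ℕ) : Set (ℝ → ℝ) :=
  {f | (∃ j ≤ k, IsStep j f) ∧ ∀ x ∈ Set.Ico (0 : ℝ) 1, |f x| ≤ L}

/-- `f` is constant on every cell `[i/n, (i+1)/n)`; for a step function this says that all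
its jumps lie on the sampling grid. -/
def ConstOnCells (n : ℕ) (f : ℝ → ℝ) : Prop :=
  ∀ i < n, ∀ x ∈ Set.Ico ((i : ℝ) / n) ((i + 1 : ℝ) / n), f x = f ((i : ℝ) / n)

/-- The local mean `n ∫_{[i/n,(i+1)/n)} f`. -/
noncomputable def cellMean (n : ℕ) (f : ℝ → ℝ) (i : Fin n) : ℝ :=
  n * ∫ x in Set.Ico ((i : ℝ) / n) ((i + 1 : ℝ) / n), f x

/-- The observations `y i = cellMean n f i + e i` for the signal `f` and the noise vector `e`. -/
noncomputable def data (n : ℕ) (f : ℝ → ℝ) (e : Fin n → ℝ) : Fin n → ℝ :=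
  fun i => cellMean n f i + e i

/-- A `c`-normal system of intervals; the pair `I` stands for the interval `[I.1, I.2)`. -/
structure IsNormalSystem (c : ℝ) (n : ℕ) (S : Set (ℝ × ℝ)) : Prop where
  /-- members are nonempty subintervals of `[0,1)` -/
  interval : ∀ I ∈ S, 0 ≤ I.1 ∧ I.1 < I.2 ∧ I.2 ≤ 1
  /-- every interval longer than `c/n` contains a member of comparable length -/
  rich : ∀ u v : ℝ, 0 ≤ u → u < v → v ≤ 1 → c / n < v - u →
    ∃ I ∈ S, u ≤ I.1 ∧ I.2 ≤ v ∧ c⁻¹ * (v - u) ≤ I.2 - I.1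
  /-- end-points lie on the grid -/
  grid : ∀ I ∈ S, (∃ i ≤ n, I.1 = (i : ℝ) / n) ∧ (∃ j ≤ n, I.2 = (j : ℝ) / n)
  /-- all cells are members -/
  cells : ∀ i < n, ((i : ℝ) / n, (i + 1 : ℝ) / n) ∈ S

open Classical in
/-- The local residual statistic `(n |I|)^{-1/2} |∑_{i/n ∈ I} (y i - v)|`. -/
noncomputable def localStat (n : ℕ) (y : Fin n → ℝ) (v : ℝ) (I : ℝ × ℝ) : ℝ :=
  |∑ i ∈ Finset.univ.filter (fun i : Fin n => (i : ℝ) / n ∈ Set.Ico I.1 I.2), (y i - v)| /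
    √(n * (I.2 - I.1))

/-- The multiscale statistic: the supremum of `localStat n y v I - s I` over the intervals `I` of
the system on which `f` is constant, with value `v`. It is extended-real valued, so the supremum
over the empty family is `-∞`. -/
noncomputable def multiscaleStat (n : ℕ) (S : Set (ℝ × ℝ)) (s : ℝ × ℝ → ℝ) (y : Fin n → ℝ)
    (f : ℝ → ℝ) : EReal :=
  ⨆ I ∈ S, ⨆ v : ℝ, ⨆ _ : ∀ x ∈ Set.Ico I.1 I.2, f x = v, ((localStat n y v I - s I : ℝ) : EReal)

/-- `g` is a candidate with `j` jumps: a step function with jumps on the grid that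
satisfies the multiscale side constraint at level `η`. The penalty may depend on the candidate. -/
def IsFeasible (n : ℕ) (S : Set (ℝ × ℝ)) (s : (ℝ → ℝ) → ℝ × ℝ → ℝ) (η : ℝ) (y : Fin n → ℝ)
    (j : ℕ) (g : ℝ → ℝ) : Prop :=
  IsStep j g ∧ ConstOnCells n g ∧ multiscaleStat n S (s g) y g ≤ (η : EReal)

/-- `fhat` minimizes the number of jumps subject to the multiscale side constraint. -/
def IsSegmentation (n : ℕ) (S : Set (ℝ × ℝ)) (s : (ℝ → ℝ) → ℝ × ℝ → ℝ) (η : ℝ) (y : Fin n → ℝ)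
    (fhat : ℝ → ℝ) : Prop :=
  ∃ j, IsFeasible n S s η y j fhat ∧ ∀ i g, IsFeasible n S s η y i g → j ≤ i

/-- A sequence `fhat n ω y` (sample size `n`, data `y`, possible further randomness `ω`) is a
multiscale change-point segmentation estimator with interval systems `S n`, penalties
`s n ω y g I`, constants `c`, `δ` and thresholds `η n`. -/
structure IsMultiscaleEstimator {Ω : Type*} [MeasurableSpace Ω] (P : Measure Ω) (c δ : ℝ)
    (η : ℕ → ℝ) (S : ℕ → Set (ℝ × ℝ))
    (s : (n : ℕ) → Ω → (Fin n → ℝ) → (ℝ → ℝ) → ℝ × ℝ → ℝ)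
    (fhat : (n : ℕ) → Ω → (Fin n → ℝ) → ℝ → ℝ) : Prop where
  normal : ∀ n, 1 ≤ n → IsNormalSystem c n (S n)
  penalty : ∀ n, 1 ≤ n → ∀ᵐ ω ∂P, ∀ y g, ∀ I ∈ S n, |s n ω y g I| ≤ δ * √(Real.log n)
  solution : ∀ n, 1 ≤ n → ∀ᵐ ω ∂P, ∀ y, IsSegmentation n (S n) (s n ω y) (η n) y (fhat n ω y)

/-- The noise array: for every `n` the variables `ξ n i`, `i < n`, are independent, centered and
sub-Gaussian with scale parameter `σ`, i.e. `E exp (u ξ) ≤ exp (u² σ² / 2)` for all real `u`. -/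
structure IsNoise {Ω : Type*} [MeasurableSpace Ω] (P : Measure Ω) (σ : ℝ)
    (ξ : (n : ℕ) → Fin n → Ω → ℝ) : Prop where
  meas : ∀ n i, Measurable (ξ n i)
  indep : ∀ n, iIndepFun (ξ n) P
  centered : ∀ n i, ∫ ω, ξ n i ω ∂P = 0
  subgaussian : ∀ n i, HasSubgaussianMGF (ξ n i) (σ ^ 2).toNNReal P

/-- Lebesgue densities `φ n i` of the noise variables. -/
structure HasNoiseDensity {Ω : Type*} [MeasurableSpace Ω] (P : Measure Ω)
    (ξ : (n : ℕ) → Fin n → Ω → ℝ) (φ : (n : ℕ) → Fin n → ℝ → ℝ) : Prop where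
  meas : ∀ n i, Measurable (φ n i)
  nonneg : ∀ n i x, 0 ≤ φ n i x
  law : ∀ n i, P.map (ξ n i) = volume.withDensity (fun x => ENNReal.ofReal (φ n i x))

/-- `∫ φ(x) log (φ(x) / φ(x+z)) dx ≤ B`, the integral being understood in `(-∞, ∞]` for a
probability density `φ`: it is finite exactly when `φ` vanishes a.e. where `φ(· + z)` does and
the integrand is integrable. -/
def ShiftKLLe (φ : ℝ → ℝ) (z B : ℝ) : Prop :=
  (∀ᵐ x, φ (x + z) = 0 → φ x = 0) ∧
    Integrable (fun x => φ x * Real.log (φ x / φ (x + z))) ∧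
      ∫ x, φ x * Real.log (φ x / φ (x + z)) ≤ B

/-- The `L^p`-(quasi-)distance on `[0,1)`. -/
noncomputable def lpDist (p : ℝ) (f g : ℝ → ℝ) : ℝ≥0∞ :=
  eLpNorm (fun x => f x - g x) (ENNReal.ofReal p) (volume.restrict (Set.Ico 0 1))

/-- The risk `(E ‖fhat(y) - f‖_{L^p}^r)^{1/r}` at the signal `f`, where `y` are the observations
with noise `e` and `fhat ω y` is the estimate. -/
noncomputable def risk {Ω : Type*} [MeasurableSpace Ω] (P : Measure Ω) (p r : ℝ) (n : ℕ)
    (e : Fin n → Ω → ℝ) (fhat : Ω → (Fin n → ℝ) → ℝ → ℝ) (f : ℝ → ℝ) : ℝ≥0∞ :=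
  (∫⁻ ω, lpDist p (fhat ω (data n f fun i => e i ω)) f ^ r ∂P) ^ (1 / r)

/-- Estimators: jointly measurable functions of the data and of the argument. -/
def Estimator (n : ℕ) : Type :=
  {g : (Fin n → ℝ) → ℝ → ℝ // Measurable (Function.uncurry g)}

/-- `(n / (2 k + 1))^{min {1/2, 1/p}}`. -/
noncomputable def invRate (p : ℝ) (n k : ℕ) : ℝ :=
  ((n : ℝ) / (2 * k + 1)) ^ min (1 / 2) (1 / p)

end Segmentation

/-!
The upper bounds rest on one event, `NoiseBound`: every sum of the noise over a block of consecutive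
cells is at most `(a - δ) √(log n)` times the root of its length. On this event the vector of cell
means of the signal satisfies the side constraint, so that the estimate has at most `2 k` jumps
(`exists_isFeasible`). The estimate and the cell means, which also have at most `2 k` jumps, then
have at most `4 k + 1` common runs. On a run of `m` cells the side constraint for a long member of
the system inside the run (or for a cell) makes their difference `O(√(log n / m))`
(`IsFeasible.abs_sub_le_of_run`). The `q`-th power of this, summed over the cells, is governed for
`q ≥ 2` by the sum of `1 / m` over all cells, that is, by the number of runs (`exists_runs`).
Working with `q = max p 2` covers all `p`, because the `L^p`-norm on `[0,1)` increases with `p`, and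
`1 / max p 2 = min (1/2) (1/p)` (`IsFeasible.lpDist_le`).

The event fails with probability `O(n^{-1-r/2})` (`IsNoise.measure_not_noiseBound_le`). This needs
more than a union bound over the `n²` blocks, which would give only `O(n^{-r})`; the point is that
`O(n log n)` blocks approximate all of them (`noiseBound_of_net`). The probabilities are summable,
so the almost sure bound follows by the Borel–Cantelli lemma. In the `r`-th moment the exceptional
event is negligible, since there the error is at most of the order `√(log n) + max |ξ i|`, by the
side constraint on the cells, and the maximum has exponential moments.

For the lower bound with `p ≤ 2`, the signals take the values `0` and `1 / √m` on each of `k + 1`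
blocks of `m ≈ n / (k + 1)` cells. Switching one block changes the Kullback–Leibler divergence by a
bounded amount, hence the Hellinger affinity, a product over the coordinates, stays away from zero,
and the two densities overlap (`HasNoiseDensity.le_add_risk`). Averaging over the hypercube at every
fixed point `x` and integrating over `x` gives the bound (`hypercube_le_iSup_risk`).

For `p > 2` no statistics is needed: `comb`, with a jump in the middle of each of the first `k` cells,
and the function of its cell means, which has one jump, produce the same data, but differ by a
constant on an interval of length `k / n` (`lpDist_le_iSup_risk`, `le_lpDist_comb`).
-/

namespace Segmentation

/-! ### Step functions and cells -/

/-- A step function with `k` jumps does not change between two points unless one of at most `k`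
break points lies between them. The upper bounds use only this property of a
step function, not its representation. -/
theorem IsStep.exists_breaks {k : ℕ} {f : ℝ → ℝ} (hf : IsStep k f) :
    ∃ T : Finset ℝ, T.card ≤ k ∧ ∀ x y, 0 ≤ x → x ≤ y → y < 1 →
      (∀ t ∈ T, x < t → y < t) → f x = f y := by
  obtain ⟨τ, c, h0, h1, -, -, hc⟩ := hf
  refine ⟨(Finset.range k).image fun l => τ (l + 1), ?_, ?_⟩
  · exact Finset.card_image_le.trans (by simp)
  intro x y hx hxy hy hT
  have hex : ∃ l, x < τ (l + 1) := ⟨k, by rw [h1]; linarith⟩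
  classical
  set l := Nat.find hex with hl
  have hlk : l ≤ k := Nat.find_min' hex (by rw [h1]; linarith)
  have hup : x < τ (l + 1) := Nat.find_spec hex
  have hlo : τ l ≤ x := by
    rcases Nat.eq_zero_or_pos l with h | h
    · rw [h, h0]; exact hx
    · have := Nat.find_min hex (m := l - 1) (by omega)
      rw [Nat.sub_add_cancel h] at this
      linarith
  have hy' : y < τ (l + 1) := by
    rcases hlk.lt_or_eq with h | h
    · exact hT _ (Finset.mem_image_of_mem _ (Finset.mem_range.2 h)) hup
    · rw [h, h1]; exact hy
  rw [hc l hlk x ⟨hlo, hup⟩, hc l hlk y ⟨hlo.trans hxy, hy'⟩]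

/-- Every sequence of cell values defines a step function in the sense of `IsStep`, after merging
cells with equal values. -/
theorem exists_isStep_of_cells {n : ℕ} (hn : 1 ≤ n) (v : ℕ → ℝ) :
    ∃ j ≤ ((Finset.range (n - 1)).filter fun i => v i ≠ v (i + 1)).card,
      IsStep j fun x => v ⌊n * x⌋₊ := by
  have hn0 : (0 : ℝ) < n := by exact_mod_cast hn
  have key : ∀ m : ℕ, ∃ j ≤ ((Finset.range m).filter fun i => v i ≠ v (i + 1)).card,
      ∃ (τ : ℕ → ℝ) (c : ℕ → ℝ), τ 0 = 0 ∧ τ (j + 1) = (m + 1 : ℝ) / n ∧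
        (∀ i ≤ j, τ i < τ (i + 1)) ∧ (∀ i < j, c i ≠ c (i + 1)) ∧ c j = v m ∧
        ∀ i ≤ j, ∀ x ∈ Set.Ico (τ i) (τ (i + 1)), v ⌊n * x⌋₊ = c i := by
    intro m
    induction m with
    | zero =>
      refine ⟨0, by simp, fun i => (i : ℝ) / n, fun _ => v 0, by simp, by simp, ?_, by simp, rfl, ?_⟩
      · intro i _; push_cast; gcongr; linarith
      · intro i hi x hx
        obtain rfl : i = 0 := by omega
        have : ⌊n * x⌋₊ = 0 := by
          rw [Nat.floor_eq_zero]
          have := hx.2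
          simp only [zero_add, Nat.cast_one, lt_div_iff₀ hn0] at this
          linarith
        rw [this]
    | succ m ih =>
      obtain ⟨j, hj, τ, c, h0, h1, hτ, hcc, hcm, hc⟩ := ih
      have hfl : ∀ x : ℝ, (m + 1 : ℝ) / n ≤ x → x < (m + 1 + 1 : ℝ) / n → ⌊n * x⌋₊ = m + 1 := by
        intro x hx1 hx2
        rw [div_le_iff₀ hn0] at hx1
        rw [lt_div_iff₀ hn0] at hx2
        rw [Nat.floor_eq_iff (by linarith [(Nat.cast_nonneg m : (0:ℝ) ≤ m)])]
        push_cast; constructor <;> linarith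
      have hlt : (m + 1 : ℝ) / n < (m + 1 + 1 : ℝ) / n := by gcongr; linarith
      rw [Finset.range_add_one, Finset.filter_insert]
      by_cases hv : v m = v (m + 1)
      · refine ⟨j, by simpa [hv] using hj, Function.update τ (j + 1) ((m + 1 + 1 : ℝ) / n), c, ?_⟩
        refine ⟨by simp [h0], by simp, ?_, hcc, by rw [hcm, hv], ?_⟩
        · intro i hi
          rw [Function.update_of_ne (by omega)]
          rcases hi.lt_or_eq with h | rfl
          · rw [Function.update_of_ne (by omega)]; exact hτ i hi
          · rw [Function.update_self]; have := hτ i le_rfl; linarith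
        · intro i hi x hx
          rw [Function.update_of_ne (by omega)] at hx
          rcases hi.lt_or_eq with h | rfl
          · rw [Function.update_of_ne (by omega)] at hx; exact hc i hi x hx
          · rw [Function.update_self] at hx
            by_cases hx' : x < τ (i + 1)
            · exact hc i le_rfl x ⟨hx.1, hx'⟩
            · rw [hfl x (by rw [← h1]; linarith) hx.2, ← hv, hcm]
      · refine ⟨j + 1, ?_, Function.update τ (j + 2) ((m + 1 + 1 : ℝ) / n),
          Function.update c (j + 1) (v (m + 1)), ?_⟩
        · rw [if_pos hv, Finset.card_insert_of_notMem (by simp)]; omega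
        refine ⟨by simp [h0], by simp, ?_, ?_, by simp, ?_⟩
        · intro i hi
          rw [Function.update_of_ne (by omega)]
          rcases hi.lt_or_eq with h | rfl
          · rw [Function.update_of_ne (by omega)]; exact hτ i (by omega)
          · rw [Function.update_self, h1]; exact hlt
        · intro i hi
          rw [Function.update_of_ne (by omega)]
          rcases (Nat.lt_succ_iff.1 hi).lt_or_eq with h | rfl
          · rw [Function.update_of_ne (by omega)]; exact hcc i h
          · rw [Function.update_self, hcm]; exact hv
        · intro i hi x hx
          rw [Function.update_of_ne (by omega)] at hx
          rcases hi.lt_or_eq with h | rfl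
          · rw [Function.update_of_ne (by omega)] at hx
            rw [Function.update_of_ne (by omega)]; exact hc i (by omega) x hx
          · rw [Function.update_self] at hx ⊢
            rw [h1] at hx
            rw [hfl x hx.1 hx.2]
  obtain ⟨j, hj, τ, c, h0, h1, hτ, hcc, -, hc⟩ := key (n - 1)
  refine ⟨j, hj, τ, c, h0, ?_, hτ, hcc, hc⟩
  rw [h1, Nat.cast_sub hn]; push_cast; rw [sub_add_cancel, div_self hn0.ne']

theorem floor_mem_cell {n : ℕ} (hn : 1 ≤ n) {x : ℝ} (hx : x ∈ Set.Ico (0 : ℝ) 1) :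
    ⌊n * x⌋₊ < n ∧ x ∈ Set.Ico ((⌊n * x⌋₊ : ℝ) / n) ((⌊n * x⌋₊ + 1 : ℝ) / n) := by
  have hn0 : (0 : ℝ) < n := by exact_mod_cast hn
  have h0 : 0 ≤ n * x := mul_nonneg hn0.le hx.1
  refine ⟨?_, ?_, ?_⟩
  · rw [Nat.floor_lt h0]; nlinarith [hx.2]
  · rw [div_le_iff₀ hn0, mul_comm x]; exact Nat.floor_le h0
  · rw [lt_div_iff₀ hn0, mul_comm x]; exact Nat.lt_floor_add_one _

theorem floor_eq_of_mem_cell {n i : ℕ} (hn : 1 ≤ n) {x : ℝ}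
    (hx : x ∈ Set.Ico ((i : ℝ) / n) ((i + 1 : ℝ) / n)) : ⌊n * x⌋₊ = i := by
  have hn0 : (0 : ℝ) < n := by exact_mod_cast hn
  have h1 := hx.1
  have h2 := hx.2
  rw [div_le_iff₀ hn0, mul_comm x] at h1
  rw [lt_div_iff₀ hn0, mul_comm x] at h2
  rw [Nat.floor_eq_iff ((Nat.cast_nonneg i).trans h1)]
  exact ⟨h1, h2⟩

theorem cell_subset {n i : ℕ} (hi : i < n) :
    Set.Ico ((i : ℝ) / n) ((i + 1 : ℝ) / n) ⊆ Set.Ico 0 1 := by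
  have hn0 : (0 : ℝ) < n := by exact_mod_cast (Nat.zero_le i).trans_lt hi
  intro x hx
  refine ⟨le_trans (by positivity) hx.1, hx.2.trans_le ?_⟩
  rw [div_le_one hn0]; exact_mod_cast hi

theorem left_mem_cell {n i : ℕ} (hn : 1 ≤ n) :
    (i : ℝ) / n ∈ Set.Ico ((i : ℝ) / n) ((i + 1 : ℝ) / n) := by
  have hn0 : (0 : ℝ) < n := by exact_mod_cast hn
  exact ⟨le_rfl, by gcongr; linarith⟩

theorem IsStep.card_jumps_le {k n : ℕ} (hn : 1 ≤ n) {g : ℝ → ℝ} (hg : IsStep k g) :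
    ((Finset.range (n - 1)).filter fun i : ℕ => g (i / n) ≠ g ((i + 1 : ℕ) / n)).card ≤ k := by
  classical
  obtain ⟨T, hT, h⟩ := hg.exists_breaks
  have hn0 : (0 : ℝ) < n := by exact_mod_cast hn
  refine (Finset.card_le_card (t := T.image fun t : ℝ => ⌈n * t⌉₊ - 1) ?_).trans
    (Finset.card_image_le.trans hT)
  intro i hi
  rw [Finset.mem_filter, Finset.mem_range] at hi
  rw [Finset.mem_image]
  by_contra hcon
  push Not at hcon
  refine hi.2 (h _ _ (by positivity) (by gcongr; simp) ?_ ?_)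
  · rw [div_lt_one hn0]; exact_mod_cast (by omega : i + 1 < n)
  · intro t ht hit
    by_contra hle
    push Not at hle
    refine hcon t ht ?_
    rw [div_lt_iff₀ hn0] at hit
    rw [le_div_iff₀ hn0] at hle
    have h1 : i < ⌈n * t⌉₊ := by rw [Nat.lt_ceil]; linarith
    have h2 : ⌈n * t⌉₊ ≤ i + 1 := by rw [Nat.ceil_le]; linarith
    omega

theorem cellMean_eq_of_const {n : ℕ} {f : ℝ → ℝ} {i : Fin n} {w : ℝ}
    (h : ∀ x ∈ Set.Ico ((i : ℝ) / n) ((i + 1 : ℝ) / n), f x = w) : cellMean n f i = w := by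
  have hn0 : (0 : ℝ) < n := by exact_mod_cast (Nat.zero_le _).trans_lt i.2
  rw [cellMean, setIntegral_congr_fun measurableSet_Ico (g := fun _ => w) h]
  simp only [integral_const, measureReal_restrict_apply_univ, Real.volume_real_Ico, smul_eq_mul]
  have : ((i : ℝ) + 1) / n - i / n = 1 / n := by ring
  rw [this, max_eq_left (by positivity)]
  field_simp

theorem abs_cellMean_le {n : ℕ} {f : ℝ → ℝ} {L : ℝ}
    (h : ∀ x ∈ Set.Ico (0 : ℝ) 1, |f x| ≤ L) (i : Fin n) : |cellMean n f i| ≤ L := by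
  have hn0 : (0 : ℝ) < n := by exact_mod_cast (Nat.zero_le _).trans_lt i.2
  have := norm_setIntegral_le_of_norm_le_const (μ := volume) (f := f)
    (s := Set.Ico ((i : ℝ) / n) ((i + 1 : ℝ) / n)) (C := L) (by simp)
    (fun x hx => h x (cell_subset i.2 hx))
  rw [Real.volume_real_Ico] at this
  have h1 : ((i : ℝ) + 1) / n - i / n = 1 / n := by ring
  rw [h1, max_eq_left (by positivity)] at this
  rw [cellMean, abs_mul, abs_of_pos hn0]
  calc (n : ℝ) * |∫ x in Set.Ico ((i : ℝ) / n) ((i + 1 : ℝ) / n), f x| ≤ n * (L * (1 / n)) := by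
        gcongr; exact this
    _ = L := by field_simp

/-- The cell means as a sequence indexed by `ℕ`, with junk value `0` from `n` on. -/
noncomputable def meanSeq (n : ℕ) (f : ℝ → ℝ) (i : ℕ) : ℝ :=
  if h : i < n then cellMean n f ⟨i, h⟩ else 0

theorem meanSeq_fin {n : ℕ} (f : ℝ → ℝ) (i : Fin n) : meanSeq n f i = cellMean n f i := by
  simp [meanSeq]

/-- A jump of a step function inside a cell makes two differences of consecutive cell means
nonzero, and a jump on the grid only one. -/
theorem IsStep.card_meanSeq_jumps_le {k n : ℕ} (hn : 1 ≤ n) {f : ℝ → ℝ} (hf : IsStep k f) :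
    ((Finset.range (n - 1)).filter fun i => meanSeq n f i ≠ meanSeq n f (i + 1)).card ≤ 2 * k := by
  classical
  obtain ⟨T, hT, h⟩ := hf.exists_breaks
  have hn0 : (0 : ℝ) < n := by exact_mod_cast hn
  refine (Finset.card_le_card (t := (T.image fun t : ℝ => ⌈n * t⌉₊ - 1) ∪
    T.image fun t : ℝ => ⌈n * t⌉₊ - 2) ?_).trans ((Finset.card_union_le _ _).trans ?_)
  swap
  · have h1 := Finset.card_image_le (s := T) (f := fun t : ℝ => ⌈n * t⌉₊ - 1)
    have h2 := Finset.card_image_le (s := T) (f := fun t : ℝ => ⌈n * t⌉₊ - 2)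
    omega
  intro i hi
  rw [Finset.mem_filter, Finset.mem_range] at hi
  rw [Finset.mem_union, Finset.mem_image, Finset.mem_image]
  by_contra hcon
  push Not at hcon
  have hc : ∀ x, (i : ℝ) / n ≤ x → x < ((i + 2 : ℕ) : ℝ) / n → f x = f (i / n) := by
    intro x hx1 hx2
    refine (h _ _ (by positivity) hx1 (hx2.trans_le ?_) ?_).symm
    · rw [div_le_one hn0]; exact_mod_cast (by omega : i + 2 ≤ n)
    · intro t ht hit
      by_contra hle
      push Not at hle
      rw [div_lt_iff₀ hn0] at hit
      rw [lt_div_iff₀ hn0] at hx2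
      have hle' : t * n ≤ x * n := by gcongr
      push_cast at hx2
      have h1 : i < ⌈n * t⌉₊ := by rw [Nat.lt_ceil]; linarith
      have h2 : ⌈n * t⌉₊ ≤ i + 2 := by rw [Nat.ceil_le]; push_cast; linarith
      have h3 := hcon.1 t ht
      have h4 := hcon.2 t ht
      omega
  refine hi.2 ?_
  rw [meanSeq, meanSeq, dif_pos (by omega), dif_pos (by omega),
    cellMean_eq_of_const (w := f (i / n)), cellMean_eq_of_const (w := f (i / n))]
  · intro x hx
    push_cast at hx
    refine hc x (le_trans (by gcongr; linarith) hx.1) (hx.2.trans_le (le_of_eq ?_))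
    push_cast; ring
  · intro x hx
    refine hc x hx.1 (hx.2.trans_le ?_)
    push_cast; gcongr; linarith

/-- A step function agrees with its cell means off the cells that have a jump inside. -/
theorem IsStep.exists_bad_cells {k n : ℕ} (hn : 1 ≤ n) {f : ℝ → ℝ} (hf : IsStep k f) :
    ∃ B : Finset ℕ, B.card ≤ k ∧ ∀ i < n, i ∉ B →
      ∀ x ∈ Set.Ico ((i : ℝ) / n) ((i + 1 : ℝ) / n), f x = meanSeq n f i := by
  classical
  obtain ⟨T, hT, h⟩ := hf.exists_breaks
  have hn0 : (0 : ℝ) < n := by exact_mod_cast hn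
  refine ⟨T.image fun t : ℝ => ⌈n * t⌉₊ - 1, Finset.card_image_le.trans hT, ?_⟩
  intro i hi hiB
  have hc : ∀ x ∈ Set.Ico ((i : ℝ) / n) ((i + 1 : ℝ) / n), f x = f (i / n) := by
    intro x hx
    refine (h _ _ (by positivity) hx.1 (cell_subset hi hx).2 ?_).symm
    intro t ht hit
    by_contra hle
    push Not at hle
    refine hiB (Finset.mem_image.2 ⟨t, ht, ?_⟩)
    rw [div_lt_iff₀ hn0] at hit
    have hx2 := hx.2
    rw [lt_div_iff₀ hn0] at hx2
    have hle' : t * n ≤ x * n := by gcongr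
    have h1 : i < ⌈n * t⌉₊ := by rw [Nat.lt_ceil]; linarith
    have h2 : ⌈n * t⌉₊ ≤ i + 1 := by rw [Nat.ceil_le]; push_cast; linarith
    omega
  intro x hx
  rw [hc x hx, meanSeq, dif_pos hi, cellMean_eq_of_const (i := ⟨i, hi⟩) hc]

/-! ### Runs -/

/-- Cutting `{0, …, n-1}` after each element of `J` gives at most `#J + 1` runs: `[lo i, hi i)`
contains the run of `i`, and the reciprocal run lengths add up to the number of runs. -/
theorem exists_runs (n : ℕ) (J : Finset ℕ) :
    ∃ lo hi : ℕ → ℕ, (∀ i < n, lo i ≤ i ∧ i < hi i ∧ hi i ≤ n ∧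
      ∀ l ∈ J, lo i ≤ l → hi i ≤ l + 1) ∧
      ∑ i ∈ Finset.range n, 1 / ((hi i : ℝ) - lo i) ≤ J.card + 1 := by
  classical
  let R : ℕ → ℕ := fun i => (J.filter (· < i)).card
  let F : ℕ → Finset ℕ := fun c => (Finset.range n).filter fun i => R i = c
  have hmem : ∀ i < n, i ∈ F (R i) := fun i hi => by simp [F, hi]
  let lo : ℕ → ℕ := fun i => if h : (F (R i)).Nonempty then (F (R i)).min' h else 0
  let hi : ℕ → ℕ := fun i => if h : (F (R i)).Nonempty then (F (R i)).max' h + 1 else 0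
  have hlo : ∀ i < n, ∃ h, lo i = (F (R i)).min' h := fun i h =>
    ⟨⟨i, hmem i h⟩, by simp only [lo]; rw [dif_pos ⟨i, hmem i h⟩]⟩
  have hhi : ∀ i < n, ∃ h, hi i = (F (R i)).max' h + 1 := fun i h =>
    ⟨⟨i, hmem i h⟩, by simp only [hi]; rw [dif_pos ⟨i, hmem i h⟩]⟩
  refine ⟨lo, hi, ?_, ?_⟩
  · intro i hin
    obtain ⟨h1, h2⟩ := hlo i hin
    obtain ⟨h3, h4⟩ := hhi i hin
    have hm1 := Finset.min'_mem _ h1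
    have hm2 := Finset.max'_mem _ h1
    rw [← h2] at hm1
    simp only [F, Finset.mem_filter, Finset.mem_range] at hm1 hm2
    refine ⟨?_, ?_, ?_, ?_⟩
    · rw [h2]; exact Finset.min'_le _ _ (hmem i hin)
    · rw [h4]; exact Nat.lt_succ_of_le (Finset.le_max' _ _ (hmem i hin))
    · rw [h4]; exact hm2.1
    · intro l hl hll
      by_contra hcon
      push Not at hcon
      rw [h4] at hcon
      set M := (F (R i)).max' h1
      have hlt : R (lo i) < R M := by
        refine Finset.card_lt_card ⟨?_, ?_⟩
        · intro x hx
          simp only [Finset.mem_filter] at hx ⊢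
          exact ⟨hx.1, by omega⟩
        · intro hsub
          have := @hsub l (by simp only [Finset.mem_filter]; exact ⟨hl, by omega⟩)
          simp only [Finset.mem_filter] at this
          omega
      have h5 : R M = R i := hm2.2
      omega
  · have hmaps : ∀ i ∈ Finset.range n, R i ∈ Finset.range (J.card + 1) := by
      intro i _
      simpa using Nat.lt_succ_of_le (Finset.card_filter_le J (· < i))
    rw [← Finset.sum_fiberwise_of_maps_to hmaps]
    calc _ ≤ ∑ c ∈ Finset.range (J.card + 1), (1 : ℝ) := by
          refine Finset.sum_le_sum fun c _ => ?_
          have hle : ∀ i ∈ (Finset.range n).filter (fun i => R i = c),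
              1 / ((hi i : ℝ) - lo i) ≤ 1 / ((F c).card : ℝ) := by
            intro i hic
            have hc : i ∈ F c := hic
            simp only [F, Finset.mem_filter, Finset.mem_range] at hc
            obtain ⟨h1, h2⟩ := hlo i hc.1
            obtain ⟨h3, h4⟩ := hhi i hc.1
            have hpos : 0 < (F c).card := Finset.card_pos.2 ⟨i, hic⟩
            have hcard : (F c).card ≤ hi i - lo i := by
              rw [← Nat.card_Ico]
              refine Finset.card_le_card fun x hx => ?_
              rw [← hc.2] at hx
              rw [Finset.mem_Ico, h2, h4]
              exact ⟨Finset.min'_le _ _ hx, Nat.lt_succ_of_le (Finset.le_max' _ _ hx)⟩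
            have hpos' : (0 : ℝ) < (F c).card := by exact_mod_cast hpos
            refine one_div_le_one_div_of_le hpos' ?_
            rw [← Nat.cast_sub (by omega)]
            exact_mod_cast hcard
          refine (Finset.sum_le_sum hle).trans ?_
          rw [Finset.sum_const, nsmul_eq_mul]
          change ((F c).card : ℝ) * _ ≤ 1
          rw [mul_one_div]
          exact div_self_le_one _
      _ = J.card + 1 := by simp

/-- A sequence without jumps on `[a, b)` is constant there. -/
theorem eq_of_no_jump {v : ℕ → ℝ} {a b : ℕ} (h : ∀ l, a ≤ l → l + 1 < b → v l = v (l + 1)) :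
    ∀ i, a ≤ i → i < b → v i = v a := by
  intro i hai
  induction i, hai using Nat.le_induction with
  | base => intro _; rfl
  | succ l hal ih => intro hl; rw [← h l hal hl]; exact ih (by omega)

/-! ### Block sums and the side constraint -/

/-- The sum of `e i` over the indices `a ≤ i < b`. -/
def blockSum {n : ℕ} (e : Fin n → ℝ) (a b : ℕ) : ℝ :=
  ∑ i with a ≤ (i : Fin n).val ∧ i.val < b, e i

theorem card_filter_block {n a b : ℕ} (hb : b ≤ n) :
    (Finset.univ.filter fun i : Fin n => a ≤ i.val ∧ i.val < b).card = b - a := by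
  rw [← Nat.card_Ico, ← Finset.card_map Fin.valEmbedding]
  congr 1
  ext x
  simp only [Finset.mem_map, Finset.mem_filter, Finset.mem_univ, true_and, Fin.valEmbedding_apply,
    Finset.mem_Ico]
  constructor
  · rintro ⟨i, hi, rfl⟩; exact hi
  · intro hx; exact ⟨⟨x, by omega⟩, hx, rfl⟩

theorem blockSum_const {n a b : ℕ} (hab : a ≤ b) (hb : b ≤ n) (w : ℝ) :
    blockSum (fun _ : Fin n => w) a b = ((b : ℝ) - a) * w := by
  rw [blockSum, Finset.sum_const, card_filter_block hb, nsmul_eq_mul, Nat.cast_sub hab]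

theorem blockSum_add {n : ℕ} (e e' : Fin n → ℝ) (a b : ℕ) :
    blockSum (fun i => e i + e' i) a b = blockSum e a b + blockSum e' a b :=
  Finset.sum_add_distrib

theorem blockSum_congr {n : ℕ} {e e' : Fin n → ℝ} {a b : ℕ}
    (h : ∀ i : Fin n, a ≤ i.val → i.val < b → e i = e' i) : blockSum e a b = blockSum e' a b :=
  Finset.sum_congr rfl fun i hi => by
    rw [Finset.mem_filter] at hi; exact h i hi.2.1 hi.2.2

theorem blockSum_split {n : ℕ} (e : Fin n → ℝ) {a b c : ℕ} (hab : a ≤ b) (hbc : b ≤ c) :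
    blockSum e a c = blockSum e a b + blockSum e b c := by
  classical
  rw [blockSum, blockSum, blockSum, ← Finset.sum_union]
  · refine Finset.sum_congr ?_ fun _ _ => rfl
    ext i
    simp only [Finset.mem_filter, Finset.mem_union, Finset.mem_univ, true_and]
    omega
  · rw [Finset.disjoint_filter]; intro i _; omega

theorem blockSum_self {n : ℕ} (e : Fin n → ℝ) (a : ℕ) : blockSum e a a = 0 := by
  rw [blockSum, Finset.filter_false_of_mem, Finset.sum_empty]
  intro i _; omega

theorem blockSum_singleton {n : ℕ} (e : Fin n → ℝ) (i : Fin n) :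
    blockSum e i.val (i.val + 1) = e i := by
  rw [blockSum, Finset.sum_eq_single_of_mem i (by simp)]
  intro j hj hji
  simp only [Finset.mem_filter] at hj
  exact absurd (Fin.ext (by omega)) hji

theorem localStat_grid {n a b : ℕ} (hn : 1 ≤ n) (y : Fin n → ℝ) (v : ℝ) :
    localStat n y v ((a : ℝ) / n, (b : ℝ) / n) =
      |blockSum (fun i => y i - v) a b| / √((b : ℝ) - a) := by
  have hn0 : (0 : ℝ) < n := by exact_mod_cast hn
  rw [localStat, blockSum]
  congr 1
  · refine congrArg abs (Finset.sum_congr ?_ fun _ _ => rfl)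
    ext i
    simp only [Finset.mem_filter, Finset.mem_univ, true_and, Set.mem_Ico,
      div_le_div_iff_of_pos_right hn0, div_lt_div_iff_of_pos_right hn0, Nat.cast_le, Nat.cast_lt]
  · rw [← sub_div, mul_div_cancel₀ _ hn0.ne']

/-- All block sums of the noise are at most `B` after division by the root of the length. -/
def NoiseBound (n : ℕ) (B : ℝ) (e : Fin n → ℝ) : Prop :=
  ∀ a b, a < b → b ≤ n → |blockSum e a b| ≤ B * √((b : ℝ) - a)

theorem NoiseBound.abs_le {n : ℕ} {B : ℝ} {e : Fin n → ℝ} (h : NoiseBound n B e) (i : Fin n) :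
    |e i| ≤ B := by
  have := h i.val (i.val + 1) (by omega) i.2
  rw [blockSum_singleton] at this
  simpa using this

/-- On the event `NoiseBound` the vector of cell means of the signal is a candidate; so the
segmentation has at most `2 k` jumps. -/
theorem exists_isFeasible {n k : ℕ} (hn : 1 ≤ n) {c δ η B : ℝ} {S : Set (ℝ × ℝ)}
    (hS : IsNormalSystem c n S) {s : (ℝ → ℝ) → ℝ × ℝ → ℝ} (hs : ∀ g, ∀ I ∈ S, |s g I| ≤ δ)
    (hη : B + δ ≤ η) {f : ℝ → ℝ} (hf : IsStep k f) {e : Fin n → ℝ} (he : NoiseBound n B e) :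
    ∃ j ≤ 2 * k, ∃ g, IsFeasible n S s η (data n f e) j g := by
  have hn0 : (0 : ℝ) < n := by exact_mod_cast hn
  obtain ⟨j, hj, hstep⟩ := exists_isStep_of_cells hn (meanSeq n f)
  refine ⟨j, hj.trans (hf.card_meanSeq_jumps_le hn), _, hstep, ?_, ?_⟩
  · intro i hi x hx
    simp only
    rw [floor_eq_of_mem_cell hn hx, floor_eq_of_mem_cell hn (left_mem_cell hn)]
  · refine iSup₂_le fun I hI => iSup_le fun v => iSup_le fun hv => ?_
    rw [EReal.coe_le_coe_iff]
    obtain ⟨⟨a, ha, haI⟩, ⟨b, hb, hbI⟩⟩ := hS.grid I hI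
    obtain rfl : I = ((a : ℝ) / n, (b : ℝ) / n) := Prod.ext haI hbI
    have hab : a < b := by
      have := (hS.interval _ hI).2.1
      simp only [div_lt_div_iff_of_pos_right hn0, Nat.cast_lt] at this
      exact this
    have hab' : (0 : ℝ) < (b : ℝ) - a := by rw [sub_pos]; exact_mod_cast hab
    have hsum : blockSum (fun i => data n f e i - v) a b = blockSum e a b := by
      refine blockSum_congr fun i hai hib => ?_
      have h1 := hv ((i : ℝ) / n) ⟨by simp only; gcongr, by simp only; gcongr⟩
      simp only at h1
      rw [floor_eq_of_mem_cell hn (left_mem_cell hn), meanSeq_fin] at h1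
      rw [data, h1]; ring
    rw [localStat_grid hn, hsum]
    have h2 : |blockSum e a b| / √((b : ℝ) - a) ≤ B := by
      rw [div_le_iff₀ (Real.sqrt_pos.2 hab')]; exact he a b hab hb
    have h3 := (abs_le.1 (hs (fun x => meanSeq n f ⌊n * x⌋₊) _ hI)).1
    linarith

theorem IsFeasible.abs_blockSum_le {n j a b : ℕ} (hn : 1 ≤ n) {δ η : ℝ} {S : Set (ℝ × ℝ)}
    {s : (ℝ → ℝ) → ℝ × ℝ → ℝ} (hs : ∀ g, ∀ I ∈ S, |s g I| ≤ δ) {y : Fin n → ℝ} {g : ℝ → ℝ}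
    (hg : IsFeasible n S s η y j g) (hb : b ≤ n) (hab : a < b)
    (hI : ((a : ℝ) / n, (b : ℝ) / n) ∈ S) {v : ℝ} (hv : ∀ i : ℕ, a ≤ i → i < b → g (i / n) = v) :
    |blockSum (fun i => y i - v) a b| ≤ (η + δ) * √((b : ℝ) - a) := by
  have hn0 : (0 : ℝ) < n := by exact_mod_cast hn
  have hab' : (0 : ℝ) < (b : ℝ) - a := by rw [sub_pos]; exact_mod_cast hab
  obtain ⟨-, hc, hm⟩ := hg
  have hconst : ∀ x ∈ Set.Ico ((a : ℝ) / n) ((b : ℝ) / n), g x = v := by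
    intro x hx
    have hx01 : x ∈ Set.Ico (0 : ℝ) 1 := by
      refine ⟨le_trans (by positivity) hx.1, hx.2.trans_le ?_⟩
      rw [div_le_one hn0]; exact_mod_cast hb
    obtain ⟨h1, h2⟩ := floor_mem_cell hn hx01
    rw [hc _ h1 x h2]
    have hx1 := hx.1
    have hx2 := hx.2
    rw [div_le_iff₀ hn0] at hx1
    rw [lt_div_iff₀ hn0] at hx2
    refine hv _ (Nat.le_floor (by linarith)) ?_
    rw [Nat.floor_lt (mul_nonneg hn0.le hx01.1)]
    linarith
  have h1 : ((localStat n y v ((a : ℝ) / n, (b : ℝ) / n) -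
      s g ((a : ℝ) / n, (b : ℝ) / n) : ℝ) : EReal) ≤ (η : EReal) := by
    refine le_trans ?_ hm
    rw [multiscaleStat]
    exact le_iSup₂_of_le _ hI (le_iSup₂_of_le v hconst le_rfl)
  rw [EReal.coe_le_coe_iff, localStat_grid hn] at h1
  have h2 := (abs_le.1 (hs g _ hI)).2
  rw [← div_le_iff₀ (Real.sqrt_pos.2 hab')]
  linarith

/-- The estimation error on a run of `b - a` cells on which the candidate and the cell means are
constant: the side constraint on a long member of the system inside the run, or on a cell, compares
both values with the mean of the data. -/
theorem IsFeasible.abs_sub_le_of_run {n j a b : ℕ} (hn : 1 ≤ n) {c δ η B : ℝ} {S : Set (ℝ × ℝ)}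
    (hc : 1 < c) (hS : IsNormalSystem c n S)
    {s : (ℝ → ℝ) → ℝ × ℝ → ℝ} (hs : ∀ g, ∀ I ∈ S, |s g I| ≤ δ) {f g : ℝ → ℝ} {e : Fin n → ℝ}
    (he : NoiseBound n B e) (hg : IsFeasible n S s η (data n f e) j g) (hb : b ≤ n) (hab : a < b)
    {v w : ℝ} (hv : ∀ i : ℕ, a ≤ i → i < b → g (i / n) = v)
    (hw : ∀ i : ℕ, a ≤ i → i < b → meanSeq n f i = w) :
    |v - w| ≤ √c * (η + δ + B) * (1 / √((b : ℝ) - a)) := by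
  have hn0 : (0 : ℝ) < n := by exact_mod_cast hn
  have hab' : (0 : ℝ) < (b : ℝ) - a := by rw [sub_pos]; exact_mod_cast hab
  have hc0 : 0 < c := by linarith
  obtain ⟨a', b', haa, hab2, hbb, hI, hlen⟩ : ∃ a' b' : ℕ, a ≤ a' ∧ a' < b' ∧ b' ≤ b ∧
      ((a' : ℝ) / n, (b' : ℝ) / n) ∈ S ∧ ((b : ℝ) - a) / c ≤ (b' : ℝ) - a' := by
    by_cases hlong : c < (b : ℝ) - a
    · obtain ⟨I, hI, h1, h2, h3⟩ := hS.rich ((a : ℝ) / n) ((b : ℝ) / n) (by positivity)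
        (by gcongr) (by rw [div_le_one hn0]; exact_mod_cast hb)
        (by rw [← sub_div]; gcongr)
      obtain ⟨⟨a', ha, haI⟩, ⟨b', hb', hbI⟩⟩ := hS.grid I hI
      obtain rfl : I = ((a' : ℝ) / n, (b' : ℝ) / n) := Prod.ext haI hbI
      have h4 := (hS.interval _ hI).2.1
      simp only [div_lt_div_iff_of_pos_right hn0, div_le_div_iff_of_pos_right hn0, Nat.cast_lt,
        Nat.cast_le] at h1 h2 h4
      refine ⟨a', b', h1, h4, h2, hI, ?_⟩
      simp only at h3
      rw [← sub_div, ← sub_div, ← mul_div_assoc, div_le_div_iff_of_pos_right hn0] at h3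
      rwa [div_eq_inv_mul]
    · refine ⟨a, a + 1, le_rfl, by omega, hab, by exact_mod_cast hS.cells a (by omega), ?_⟩
      push Not at hlong
      rw [div_le_iff₀ hc0]; push_cast; linarith
  have hab3 : (0 : ℝ) < (b' : ℝ) - a' := by rw [sub_pos]; exact_mod_cast hab2
  have h1 := hg.abs_blockSum_le hn hs (by omega) hab2 hI (v := v)
    fun i h1 h2 => hv i (by omega) (by omega)
  have h2 := he a' b' hab2 (by omega)
  have h3 : blockSum (fun i => data n f e i - v) a' b' =
      ((b' : ℝ) - a') * (w - v) + blockSum e a' b' := by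
    rw [← blockSum_const (n := n) hab2.le (by omega), ← blockSum_add]
    refine blockSum_congr fun i hi1 hi2 => ?_
    rw [data, ← meanSeq_fin, hw i (by omega) (by omega)]; ring
  have h4 : ((b' : ℝ) - a') * |v - w| ≤ (η + δ + B) * √((b' : ℝ) - a') := by
    rw [← abs_of_pos hab3, ← abs_mul, abs_of_pos hab3]
    have : ((b' : ℝ) - a') * (v - w) =
        blockSum e a' b' - blockSum (fun i => data n f e i - v) a' b' := by rw [h3]; ring
    rw [this]
    calc _ ≤ |blockSum e a' b'| + |blockSum (fun i => data n f e i - v) a' b'| := abs_sub _ _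
      _ ≤ _ := by linarith
  have hs3 := Real.sqrt_pos.2 hab3
  have h5 : |v - w| * √((b' : ℝ) - a') ≤ η + δ + B := by
    refine le_of_mul_le_mul_right ?_ hs3
    rw [mul_assoc, Real.mul_self_sqrt hab3.le]; linarith
  have h6 : √((b : ℝ) - a) ≤ √c * √((b' : ℝ) - a') := by
    rw [← Real.sqrt_mul hc0.le]
    refine Real.sqrt_le_sqrt ?_
    rw [div_le_iff₀ hc0] at hlen; linarith
  rw [mul_one_div, le_div_iff₀ (Real.sqrt_pos.2 hab')]
  calc |v - w| * √((b : ℝ) - a) ≤ |v - w| * (√c * √((b' : ℝ) - a')) := by gcongr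
    _ = √c * (|v - w| * √((b' : ℝ) - a')) := by ring
    _ ≤ _ := by gcongr

/-! ### Bounds for the `L^p`-distance -/

theorem isProbabilityMeasure_restrict_Ico :
    IsProbabilityMeasure (volume.restrict (Set.Ico (0 : ℝ) 1)) := ⟨by simp⟩

/-- The majorant `D` is measurable, which the functions `f` and `g` need not be outside `[0,1)`. -/
theorem lpDist_le_of_cells {n : ℕ} (hn : 1 ≤ n) {p q : ℝ} (hq : 0 < q) (hpq : p ≤ q)
    {f g : ℝ → ℝ} {D : ℕ → ℝ} (hD : ∀ i, 0 ≤ D i)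
    (h : ∀ i < n, ∀ x ∈ Set.Ico ((i : ℝ) / n) ((i + 1 : ℝ) / n), |g x - f x| ≤ D i) :
    lpDist p g f ≤ ENNReal.ofReal (((∑ i ∈ Finset.range n, D i ^ q) / n) ^ (1 / q)) := by
  have := isProbabilityMeasure_restrict_Ico
  have hn0 : (0 : ℝ) < n := by exact_mod_cast hn
  have hmeas : Measurable fun x : ℝ => D ⌊n * x⌋₊ :=
    (measurable_from_nat (f := D)).comp (Nat.measurable_floor.comp (measurable_const_mul _))
  have hq' : ENNReal.ofReal q ≠ 0 := by simpa using hq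
  calc lpDist p g f ≤ eLpNorm (fun x : ℝ => D ⌊n * x⌋₊) (ENNReal.ofReal p)
        (volume.restrict (Set.Ico 0 1)) := by
        refine eLpNorm_mono_ae_real ?_
        filter_upwards [ae_restrict_mem measurableSet_Ico] with x hx
        obtain ⟨h1, h2⟩ := floor_mem_cell hn hx
        exact h _ h1 x h2
    _ ≤ eLpNorm (fun x : ℝ => D ⌊n * x⌋₊) (ENNReal.ofReal q) (volume.restrict (Set.Ico 0 1)) :=
        eLpNorm_le_eLpNorm_of_exponent_le (ENNReal.ofReal_le_ofReal hpq) hmeas.aestronglyMeasurable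
    _ ≤ _ := by
        rw [eLpNorm_eq_lintegral_rpow_enorm_toReal hq' ENNReal.ofReal_ne_top,
          ENNReal.toReal_ofReal hq.le, ← ENNReal.ofReal_rpow_of_nonneg
            (div_nonneg (Finset.sum_nonneg fun i _ => Real.rpow_nonneg (hD i) _) hn0.le)
            (by positivity)]
        refine ENNReal.rpow_le_rpow ?_ (by positivity)
        have hsub : Set.Ico (0 : ℝ) 1 ⊆
            ⋃ i : Fin n, Set.Ico ((i : ℝ) / n) ((i + 1 : ℝ) / n) := by
          intro x hx
          obtain ⟨h1, h2⟩ := floor_mem_cell hn hx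
          exact Set.mem_iUnion.2 ⟨⟨_, h1⟩, h2⟩
        refine (lintegral_mono_set hsub).trans ((lintegral_iUnion_le _ _).trans ?_)
        rw [tsum_fintype, Finset.sum_div, ENNReal.ofReal_sum_of_nonneg
          (fun i _ => div_nonneg (Real.rpow_nonneg (hD i) _) hn0.le), Finset.sum_range]
        refine Finset.sum_le_sum fun i _ => ?_
        rw [setLIntegral_congr_fun measurableSet_Ico
          (g := fun _ => ENNReal.ofReal (D i ^ q))]
        · rw [setLIntegral_const, Real.volume_Ico, ← ENNReal.ofReal_mul (Real.rpow_nonneg (hD i) _)]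
          refine ENNReal.ofReal_le_ofReal (le_of_eq ?_)
          ring
        · intro x hx
          simp only
          rw [floor_eq_of_mem_cell hn hx, Real.enorm_eq_ofReal (hD _),
            ENNReal.ofReal_rpow_of_nonneg (hD _) hq.le]

theorem lpDist_le_const {n : ℕ} (hn : 1 ≤ n) {p : ℝ} {f g : ℝ → ℝ} {M : ℝ} (hM : 0 ≤ M)
    (h : ∀ i < n, ∀ x ∈ Set.Ico ((i : ℝ) / n) ((i + 1 : ℝ) / n), |g x - f x| ≤ M) :
    lpDist p g f ≤ ENNReal.ofReal M := by
  have hn0 : (0 : ℝ) < n := by exact_mod_cast hn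
  have hq : 0 < max p 2 := lt_max_of_lt_right two_pos
  refine (lpDist_le_of_cells hn hq (le_max_left p 2)
    (D := fun _ => M) (fun _ => hM) h).trans (le_of_eq ?_)
  rw [Finset.sum_const, Finset.card_range, nsmul_eq_mul, mul_div_cancel_left₀ _ hn0.ne',
    ← Real.rpow_mul hM, mul_one_div_cancel hq.ne', Real.rpow_one]

/-- The deterministic core of the upper bound: on the event `NoiseBound` a candidate with at most
`2 k` jumps and the cell means have at most `4 k + 1` common runs, and at most `k` cells have a
jump of `f` inside. -/
theorem IsFeasible.lpDist_le {n j k : ℕ} (hn : 1 ≤ n) {p c δ η B L : ℝ} {S : Set (ℝ × ℝ)}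
    (hc : 1 < c) (hS : IsNormalSystem c n S) (hL : 0 ≤ L)
    {s : (ℝ → ℝ) → ℝ × ℝ → ℝ} (hs : ∀ g, ∀ I ∈ S, |s g I| ≤ δ) {f g : ℝ → ℝ} {e : Fin n → ℝ}
    (hB : 0 ≤ η + δ + B) (he : NoiseBound n B e) (hg : IsFeasible n S s η (data n f e) j g)
    (hj : j ≤ 2 * k) (hf : f ∈ boundedSteps L k) :
    lpDist p g f ≤ ENNReal.ofReal
      (3 * (√c * (η + δ + B) + 2 * L) * ((2 * k + 1 : ℝ) / n) ^ (1 / max p 2)) := by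
  classical
  have hn0 : (0 : ℝ) < n := by exact_mod_cast hn
  set q := max p 2 with hq
  have hq2 : 2 ≤ q := le_max_right _ _
  have hq0 : 0 < q := by linarith
  obtain ⟨⟨k', hk', hfs⟩, hfL⟩ := hf
  obtain ⟨bad, hbadc, hbad⟩ := hfs.exists_bad_cells hn
  set C := √c * (η + δ + B) with hC
  have hC0 : 0 ≤ C := by positivity
  set J1 := (Finset.range (n - 1)).filter fun i : ℕ => g (i / n) ≠ g ((i + 1 : ℕ) / n)
  set J2 := (Finset.range (n - 1)).filter fun i => meanSeq n f i ≠ meanSeq n f (i + 1)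
  have hJ1 : J1.card ≤ j := hg.1.card_jumps_le hn
  have hJ2 : J2.card ≤ 2 * k' := hfs.card_meanSeq_jumps_le hn
  have hJ : (J1 ∪ J2).card ≤ 4 * k := (Finset.card_union_le _ _).trans (by omega)
  obtain ⟨lo, hi, hrun, hsum⟩ := exists_runs n (J1 ∪ J2)
  let m : ℕ → ℝ := fun i => (hi i : ℝ) - lo i
  let D : ℕ → ℝ := fun i => (C + 2 * L) * max (1 / √(m i)) (if i ∈ bad then 1 else 0)
  have hD : ∀ i, 0 ≤ D i := fun i =>
    mul_nonneg (by linarith) (le_max_of_le_left (by positivity))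
  have hcell : ∀ i < n, ∀ x ∈ Set.Ico ((i : ℝ) / n) ((i + 1 : ℝ) / n), |g x - f x| ≤ D i := by
    intro i hin x hx
    obtain ⟨h1, h2, h3, h4⟩ := hrun i hin
    have e1 := eq_of_no_jump (v := fun l : ℕ => g (l / n)) (a := lo i) (b := hi i) (by
      intro l hl1 hl2
      by_contra hne
      have := h4 l (Finset.mem_union_left _ (Finset.mem_filter.2
        ⟨Finset.mem_range.2 (by omega), hne⟩)) hl1
      omega)
    have e2 := eq_of_no_jump (v := meanSeq n f) (a := lo i) (b := hi i) (by
      intro l hl1 hl2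
      by_contra hne
      have := h4 l (Finset.mem_union_right _ (Finset.mem_filter.2
        ⟨Finset.mem_range.2 (by omega), hne⟩)) hl1
      omega)
    have h5 := hg.abs_sub_le_of_run hn hc hS hs he h3 (by omega) e1 e2
    have h6 : g x = g (lo i / n) := by rw [hg.2.1 i hin x hx, ← e1 i h1 h2]
    have h7 : meanSeq n f i = meanSeq n f (lo i) := e2 i h1 h2
    rw [← h6, ← h7] at h5
    change _ ≤ (C + 2 * L) * _
    have h8 : |g x - meanSeq n f i| ≤ C * max (1 / √(m i)) (if i ∈ bad then 1 else 0) :=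
      h5.trans (by gcongr; exact le_max_left _ _)
    by_cases hib : i ∈ bad
    · have h9 : |meanSeq n f i - f x| ≤ 2 * L := by
        have a1 := hfL x (cell_subset hin hx)
        have a2 := abs_cellMean_le hfL ⟨i, hin⟩
        rw [← meanSeq_fin] at a2
        have := abs_sub (meanSeq n f i) (f x)
        simp only at a2
        linarith
      have h10 : (1 : ℝ) ≤ max (1 / √(m i)) (if i ∈ bad then 1 else 0) := by
        rw [if_pos hib]; exact le_max_right _ _
      have h11 := abs_sub_le (g x) (meanSeq n f i) (f x)
      nlinarith
    · rw [hbad i hin hib x hx]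
      refine h8.trans ?_
      have : 0 ≤ max (1 / √(m i)) (if i ∈ bad then 1 else 0) :=
        le_max_of_le_left (by positivity)
      nlinarith
  refine (lpDist_le_of_cells hn hq0 (le_max_left p 2) hD hcell).trans
    (ENNReal.ofReal_le_ofReal ?_)
  have hDq : ∀ i ∈ Finset.range n, D i ^ q ≤
      (C + 2 * L) ^ q * (1 / m i + if i ∈ bad then 1 else 0) := by
    intro i hin
    obtain ⟨h1, h2, h3, h4⟩ := hrun i (Finset.mem_range.1 hin)
    have hm1 : 1 ≤ m i := by
      have : ((lo i + 1 : ℕ) : ℝ) ≤ hi i := by exact_mod_cast (by omega : lo i + 1 ≤ hi i)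
      push_cast at this
      simp only [m]; linarith
    rw [Real.mul_rpow (by linarith) (le_max_of_le_left (by positivity))]
    gcongr
    have hs1 : 1 ≤ √(m i) := by rw [Real.one_le_sqrt]; exact hm1
    have h5 : (1 / √(m i)) ^ q ≤ 1 / m i := by
      calc (1 / √(m i)) ^ q ≤ (1 / √(m i)) ^ (2 : ℝ) :=
            Real.rpow_le_rpow_of_exponent_ge (by positivity)
              (by rw [div_le_one (by positivity)]; exact hs1) hq2
        _ = 1 / m i := by
            rw [Real.rpow_two, div_pow, one_pow, Real.sq_sqrt (by linarith)]
    have h6 : 0 ≤ 1 / m i := by positivity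
    split_ifs
    · rw [max_eq_right (by rw [div_le_one (by positivity)]; exact hs1), Real.one_rpow]
      linarith
    · rw [max_eq_left (by positivity)]; linarith
  have hbadsum : ∑ i ∈ Finset.range n, (if i ∈ bad then (1 : ℝ) else 0) ≤ k := by
    rw [Finset.sum_ite_mem, Finset.sum_const, nsmul_eq_mul, mul_one]
    exact_mod_cast (Finset.card_le_card Finset.inter_subset_right).trans (hbadc.trans hk')
  have hJr : ((J1 ∪ J2).card : ℝ) ≤ 4 * k := by exact_mod_cast hJ
  have htot : ∑ i ∈ Finset.range n, D i ^ q ≤ (C + 2 * L) ^ q * (3 * (2 * k + 1)) := by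
    refine (Finset.sum_le_sum hDq).trans ?_
    rw [← Finset.mul_sum, Finset.sum_add_distrib]
    have hk0 : (0 : ℝ) ≤ k := Nat.cast_nonneg k
    gcongr
    linarith
  calc ((∑ i ∈ Finset.range n, D i ^ q) / n) ^ (1 / q)
      ≤ ((C + 2 * L) ^ q * (3 * ((2 * k + 1) / n))) ^ (1 / q) := by
        refine Real.rpow_le_rpow (div_nonneg (Finset.sum_nonneg fun i _ =>
          Real.rpow_nonneg (hD i) _) hn0.le) ?_ (by positivity)
        rw [div_le_iff₀ hn0]
        refine htot.trans (le_of_eq ?_)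
        field_simp
    _ = (C + 2 * L) * (3 ^ (1 / q) * ((2 * k + 1 : ℝ) / n) ^ (1 / q)) := by
        rw [Real.mul_rpow (by positivity) (by positivity), ← Real.rpow_mul (by positivity),
          mul_one_div_cancel hq0.ne', Real.rpow_one, Real.mul_rpow (by positivity) (by positivity)]
    _ ≤ (C + 2 * L) * (3 * ((2 * k + 1 : ℝ) / n) ^ (1 / q)) := by
        gcongr
        calc (3 : ℝ) ^ (1 / q) ≤ 3 ^ (1 : ℝ) :=
              Real.rpow_le_rpow_of_exponent_le (by norm_num)
                (by rw [div_le_one hq0]; linarith)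
          _ = 3 := Real.rpow_one 3
    _ = _ := by ring

/-- The crude bound that holds for all noise vectors, from the side constraint on the cells. -/
theorem IsFeasible.lpDist_le_crude {n j k : ℕ} (hn : 1 ≤ n) {p c δ η Z L : ℝ} {S : Set (ℝ × ℝ)}
    (hS : IsNormalSystem c n S) (hL : 0 ≤ L) (hη : 0 ≤ η + δ) (hZ0 : 0 ≤ Z)
    {s : (ℝ → ℝ) → ℝ × ℝ → ℝ} (hs : ∀ g, ∀ I ∈ S, |s g I| ≤ δ) {f g : ℝ → ℝ} {e : Fin n → ℝ}
    (hZ : ∀ i, |e i| ≤ Z) (hg : IsFeasible n S s η (data n f e) j g)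
    (hf : f ∈ boundedSteps L k) :
    lpDist p g f ≤ ENNReal.ofReal (η + δ + Z + 2 * L) := by
  refine lpDist_le_const hn (by linarith) fun i hin x hx => ?_
  have h1 := hg.abs_blockSum_le hn hs (a := i) (b := i + 1) hin (by omega)
    (by exact_mod_cast hS.cells i hin) (v := g x) (by
      intro l hl1 hl2
      obtain rfl : l = i := by omega
      exact (hg.2.1 l hin x hx).symm)
  rw [blockSum_singleton _ ⟨i, hin⟩] at h1
  simp only [Nat.cast_add, Nat.cast_one, add_sub_cancel_left, Real.sqrt_one, mul_one, data] at h1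
  have h2 := abs_cellMean_le hf.2 ⟨i, hin⟩
  have h3 := hf.2 x (cell_subset hin hx)
  have h4 := hZ ⟨i, hin⟩
  rw [abs_le] at *
  constructor <;> linarith

/-! ### The maximum of the normalized block sums of the noise -/

/-- Every block is, up to two short pieces, a block `[i q, (i + j) q)` with `j ≤ 2 M`: take for `q`
the `M`-th part of its length. So a bound for these blocks, of which there are only about
`M n log n`, gives almost the same bound for all blocks. -/
theorem noiseBound_of_net {n M : ℕ} (hM : 2 ≤ M) {K b B : ℝ} (hK : 0 ≤ K) (hb : 0 ≤ b)
    (hB : b + 2 * K / √M ≤ B) {e : Fin n → ℝ} (hall : NoiseBound n K e)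
    (hnet : ∀ q i j : ℕ, 1 ≤ q → q ≤ n → 1 ≤ j → j ≤ 2 * M → (i + j) * q ≤ n →
      |blockSum e (i * q) ((i + j) * q)| ≤ b * √((((i + j) * q : ℕ) : ℝ) - (i * q : ℕ))) :
    NoiseBound n B e := by
  intro a c hac hcn
  have hM0 : (0 : ℝ) < M := by exact_mod_cast (by omega : 0 < M)
  have hKM : 0 ≤ 2 * K / √M := by positivity
  obtain h1 | h1 := Nat.lt_or_ge (c - a) (2 * M)
  -- A short block is itself in the net, with spacing `q = 1`.
  · have h := hnet 1 a (c - a) le_rfl (by omega) (by omega) h1.le (by omega)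
    rw [mul_one, mul_one, Nat.add_sub_cancel' hac.le] at h
    exact h.trans (by gcongr; linarith)
  · set q := (c - a) / M with hq
    have hMpos : 0 < M := by omega
    have hq1 : 1 ≤ q := (Nat.one_le_div_iff hMpos).2 (by omega)
    have hqM : q * M ≤ c - a := Nat.div_mul_le_self _ _
    have hqM' : c - a < (q + 1) * M := by
      have := Nat.lt_mul_div_succ (c - a) hMpos
      rw [mul_comm] at this
      exact this
    set i := (a + q - 1) / q with hi
    set d := c / q with hd
    have hi1 : i * q ≤ a + q - 1 := Nat.div_mul_le_self _ _
    have hi2 : a ≤ i * q := by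
      have := Nat.lt_mul_div_succ (a + q - 1) hq1
      rw [← hi] at this
      have h3 : q * (i + 1) = i * q + q := by ring
      omega
    have hd1 : d * q ≤ c := Nat.div_mul_le_self _ _
    have hd2 : c < d * q + q := by
      have := Nat.lt_mul_div_succ c hq1
      rw [← hd] at this
      have h3 : q * (d + 1) = d * q + q := by ring
      omega
    have h2q : 2 * q ≤ c - a := le_trans (by rw [mul_comm]; gcongr) hqM
    have hid : i < d := by
      by_contra hcon
      push Not at hcon
      have : d * q ≤ i * q := by gcongr
      omega
    clear_value d
    obtain ⟨j, rfl⟩ : ∃ j, d = i + j := ⟨d - i, by omega⟩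
    have hj : j ≤ 2 * M := by
      by_contra hcon
      push Not at hcon
      have e1 : (i + j) * q = i * q + j * q := by ring
      have e2 : (2 * M + 1) * q ≤ j * q := by gcongr; omega
      have e3 : (2 * M + 1) * q = M * q + M * q + q := by ring
      have e4 : (q + 1) * M = M * q + M := by ring
      have e5 : M * 1 ≤ M * q := by gcongr
      omega
    have hmid := hnet q i j hq1 (by omega) (by omega) hj (by omega)
    have hpiece : ∀ x y : ℕ, x ≤ y → y ≤ n → y - x ≤ q →
        |blockSum e x y| ≤ K / √M * √((c : ℝ) - a) := by
      intro x y hxy hyn hlen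
      rcases hxy.eq_or_lt with rfl | hlt
      · rw [blockSum_self, abs_zero]; positivity
      refine (hall x y hlt hyn).trans ?_
      rw [div_mul_eq_mul_div, mul_div_assoc]
      refine mul_le_mul_of_nonneg_left ?_ hK
      rw [le_div_iff₀ (Real.sqrt_pos.2 hM0), ← Real.sqrt_mul]
      · refine Real.sqrt_le_sqrt ?_
        rw [← Nat.cast_sub hxy, ← Nat.cast_sub hac.le, ← Nat.cast_mul]
        exact_mod_cast le_trans (by gcongr) hqM
      · rw [sub_nonneg]; exact_mod_cast hxy
    have hp1 := hpiece a (i * q) hi2 (by omega) (by omega)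
    have hp2 := hpiece ((i + j) * q) c hd1 hcn (by omega)
    have hle : i * q ≤ (i + j) * q := by gcongr
    rw [blockSum_split e hi2 (hle.trans hd1), blockSum_split e hle hd1]
    have hmid' : |blockSum e (i * q) ((i + j) * q)| ≤ b * √((c : ℝ) - a) := by
      refine hmid.trans ?_
      gcongr
    calc _ ≤ |blockSum e a (i * q)| + (|blockSum e (i * q) ((i + j) * q)| +
          |blockSum e ((i + j) * q) c|) :=
          (abs_add_le _ _).trans (by gcongr; exact abs_add_le _ _)
      _ ≤ (b + 2 * K / √M) * √((c : ℝ) - a) := by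
          rw [mul_div_assoc]; linarith
      _ ≤ _ := by gcongr

section Noise

variable {Ω : Type*} [MeasurableSpace Ω] {P : Measure Ω} {σ : ℝ}
  {ξ : (n : ℕ) → Fin n → Ω → ℝ}

/-- The event that the normalized block sum over `[a, b)` exceeds `t √(log n)`. -/
def exceedSet (ξ : (n : ℕ) → Fin n → Ω → ℝ) (n : ℕ) (t : ℝ) (a b : ℕ) : Set Ω :=
  {ω | a < b ∧ b ≤ n ∧
    t * √(Real.log n) * √((b : ℝ) - a) < |blockSum (fun i => ξ n i ω) a b|}

theorem IsNoise.measure_exceedSet_le [IsProbabilityMeasure P] (hξ : IsNoise P σ ξ) (hσ : 0 < σ) {n : ℕ} (hn : 1 ≤ n)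
    {t : ℝ} (ht : 0 ≤ t) (a b : ℕ) :
    P (exceedSet ξ n t a b) ≤ ENNReal.ofReal (2 * (n : ℝ) ^ (-(t ^ 2 / (2 * σ ^ 2)))) := by
  have hn0 : (0 : ℝ) < n := by exact_mod_cast hn
  have hlog : 0 ≤ Real.log n := Real.log_nonneg (by exact_mod_cast hn)
  by_cases hab : a < b ∧ b ≤ n
  swap
  · have : exceedSet ξ n t a b = ∅ :=
      Set.eq_empty_of_forall_notMem fun ω hω => hab ⟨hω.1, hω.2.1⟩
    rw [this, measure_empty]
    exact zero_le
  have hab' : (0 : ℝ) < (b : ℝ) - a := by rw [sub_pos]; exact_mod_cast hab.1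
  have hsub : HasSubgaussianMGF (fun ω => blockSum (fun i => ξ n i ω) a b)
      (∑ i with a ≤ (i : Fin n).val ∧ i.val < b, (σ ^ 2).toNNReal) P :=
    HasSubgaussianMGF.sum_of_iIndepFun (hξ.indep n) (c := fun _ => (σ ^ 2).toNNReal)
      fun i _ => hξ.subgaussian n i
  rw [Finset.sum_const, card_filter_block hab.2] at hsub
  set ε := t * √(Real.log n) * √((b : ℝ) - a) with hε
  have hε0 : 0 ≤ ε := by positivity
  have hexp : Real.exp (-ε ^ 2 / (2 * ((b - a) • (σ ^ 2).toNNReal : NNReal))) =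
      (n : ℝ) ^ (-(t ^ 2 / (2 * σ ^ 2))) := by
    rw [Real.rpow_def_of_pos hn0]
    congr 1
    rw [NNReal.coe_nsmul, Real.coe_toNNReal _ (sq_nonneg σ), hε, mul_pow, mul_pow,
      Real.sq_sqrt hlog, Real.sq_sqrt hab'.le, nsmul_eq_mul, Nat.cast_sub hab.1.le]
    field_simp
  have h1 := hsub.measure_ge_le hε0
  have h2 := hsub.neg.measure_ge_le hε0
  rw [hexp] at h1 h2
  calc P (exceedSet ξ n t a b) ≤ P ({ω | ε ≤ blockSum (fun i => ξ n i ω) a b} ∪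
        {ω | ε ≤ (-fun ω => blockSum (fun i => ξ n i ω) a b) ω}) := by
        refine measure_mono fun ω hω => ?_
        exact le_abs.1 hω.2.2.le
    _ ≤ _ := measure_union_le _ _
    _ ≤ ENNReal.ofReal ((n : ℝ) ^ (-(t ^ 2 / (2 * σ ^ 2)))) +
        ENNReal.ofReal ((n : ℝ) ^ (-(t ^ 2 / (2 * σ ^ 2)))) := by
        rw [← ofReal_measureReal, ← ofReal_measureReal]
        gcongr
    _ = _ := by
        rw [← ENNReal.ofReal_add (by positivity) (by positivity), ← two_mul]

/-- The bound `B √(log n)` for all normalized block sums fails with probability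
`O(n^{-1-ρ/2})` as soon as `B > σ √(2 ρ + 4)`. A union bound over all `n²` blocks would only
give `O(n^{-ρ})`, which is not summable for small `ρ`. -/
theorem IsNoise.measure_not_noiseBound_le [IsProbabilityMeasure P] (hξ : IsNoise P σ ξ) (hσ : 0 < σ) {ρ B : ℝ}
    (hρ : 0 < ρ) (hB : σ * √(2 * ρ + 4) < B) :
    ∃ C, 0 ≤ C ∧ ∀ n : ℕ, 1 ≤ n →
      P {ω | ¬ NoiseBound n (B * √(Real.log n)) fun i => ξ n i ω} ≤
        ENNReal.ofReal (C * (n : ℝ) ^ (-(1 + ρ / 2))) := by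
  set b := σ * √(2 * ρ + 4) with hb
  set K := σ * √(2 * ρ + 6) with hK
  have hb0 : 0 ≤ b := by positivity
  have hK0 : 0 ≤ K := by positivity
  have hbsq : b ^ 2 / (2 * σ ^ 2) = ρ + 2 := by
    rw [hb, mul_pow, Real.sq_sqrt (by positivity)]; field_simp; ring
  have hKsq : K ^ 2 / (2 * σ ^ 2) = ρ + 3 := by
    rw [hK, mul_pow, Real.sq_sqrt (by positivity)]; field_simp; ring
  obtain ⟨M, hM2, hM⟩ : ∃ M : ℕ, 2 ≤ M ∧ b + 2 * K / √M ≤ B := by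
    have h1 : Tendsto (fun M : ℕ => b + 2 * K / √(M : ℝ)) atTop (𝓝 (b + 0)) :=
      tendsto_const_nhds.add (Tendsto.div_atTop tendsto_const_nhds
        (Real.tendsto_sqrt_atTop.comp tendsto_natCast_atTop_atTop))
    rw [add_zero] at h1
    obtain ⟨M, h2, h3⟩ := ((eventually_ge_atTop 2).and (h1.eventually_lt_const hB)).exists
    exact ⟨M, h2, h3.le⟩
  refine ⟨8 + 8 * M * (1 + 2 / ρ), by positivity, fun n hn => ?_⟩
  have hn0 : (0 : ℝ) < n := by exact_mod_cast hn
  have hn1 : (1 : ℝ) ≤ n := by exact_mod_cast hn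
  have hlog : 0 ≤ Real.log n := Real.log_nonneg hn1
  set α := (n : ℝ) ^ (-(ρ + 3)) with hα
  set β := (n : ℝ) ^ (-(ρ + 2)) with hβ
  have hα0 : 0 ≤ α := by positivity
  have hβ0 : 0 ≤ β := by positivity
  have hsub : {ω | ¬ NoiseBound n (B * √(Real.log n)) fun i => ξ n i ω} ⊆
      (⋃ a ∈ Finset.range (n + 1), ⋃ c ∈ Finset.range (n + 1), exceedSet ξ n K a c) ∪
      ⋃ q ∈ Finset.Icc 1 n, ⋃ i ∈ Finset.range (n / q + 1), ⋃ j ∈ Finset.Icc 1 (2 * M),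
        exceedSet ξ n b (i * q) ((i + j) * q) := by
    intro ω hω
    by_contra hcon
    simp only [Set.mem_union, Set.mem_iUnion, not_or, not_exists, Finset.mem_range,
      Finset.mem_Icc] at hcon
    refine hω (noiseBound_of_net hM2 (K := K * √(Real.log n)) (b := b * √(Real.log n))
      (by positivity) (by positivity) ?_ ?_ ?_)
    · calc _ = (b + 2 * K / √M) * √(Real.log n) := by ring
        _ ≤ _ := by gcongr
    · intro a c hac hcn
      by_contra hlt
      push Not at hlt
      exact hcon.1 a (by omega) c (by omega) ⟨hac, hcn, hlt⟩
    · intro q i j hq hqn hj hjM hijn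
      by_contra hlt
      push Not at hlt
      have hi : i ≤ n / q := by
        rw [Nat.le_div_iff_mul_le hq]
        exact le_trans (by gcongr; omega) hijn
      exact hcon.2 q ⟨hq, hqn⟩ i (by omega) j ⟨hj, hjM⟩
        ⟨by gcongr; omega, hijn, hlt⟩
  have h1 : P (⋃ a ∈ Finset.range (n + 1), ⋃ c ∈ Finset.range (n + 1), exceedSet ξ n K a c) ≤
      ENNReal.ofReal (8 * ((n : ℝ) ^ 2 * α)) := by
    calc _ ≤ ∑ a ∈ Finset.range (n + 1), ∑ c ∈ Finset.range (n + 1), P (exceedSet ξ n K a c) :=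
          (measure_biUnion_finset_le _ _).trans
            (Finset.sum_le_sum fun a _ => measure_biUnion_finset_le _ _)
      _ ≤ ∑ a ∈ Finset.range (n + 1), ∑ c ∈ Finset.range (n + 1), ENNReal.ofReal (2 * α) := by
          gcongr with a _ c _
          have := hξ.measure_exceedSet_le hσ hn hK0 a c
          rwa [hKsq] at this
      _ = ENNReal.ofReal (((n : ℝ) + 1) * (((n : ℝ) + 1) * (2 * α))) := by
          rw [Finset.sum_const, Finset.sum_const, Finset.card_range, nsmul_eq_mul, nsmul_eq_mul,
            ENNReal.ofReal_mul (p := (n : ℝ) + 1) (by positivity),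
            ENNReal.ofReal_mul (p := (n : ℝ) + 1) (by positivity)]
          norm_cast
      _ ≤ _ := by
          refine ENNReal.ofReal_le_ofReal ?_
          have : ((n : ℝ) + 1) * ((n : ℝ) + 1) ≤ 4 * (n : ℝ) ^ 2 := by nlinarith
          nlinarith
  have h2 : P (⋃ q ∈ Finset.Icc 1 n, ⋃ i ∈ Finset.range (n / q + 1), ⋃ j ∈ Finset.Icc 1 (2 * M),
        exceedSet ξ n b (i * q) ((i + j) * q)) ≤
      ENNReal.ofReal (8 * M * ((1 + Real.log n) * (n * β))) := by
    calc _ ≤ ∑ q ∈ Finset.Icc 1 n, ∑ i ∈ Finset.range (n / q + 1), ∑ j ∈ Finset.Icc 1 (2 * M),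
            P (exceedSet ξ n b (i * q) ((i + j) * q)) :=
          (measure_biUnion_finset_le _ _).trans
            (Finset.sum_le_sum fun a _ => (measure_biUnion_finset_le _ _).trans
              (Finset.sum_le_sum fun a _ => measure_biUnion_finset_le _ _))
      _ ≤ ∑ q ∈ Finset.Icc 1 n, ∑ i ∈ Finset.range (n / q + 1), ∑ j ∈ Finset.Icc 1 (2 * M),
            ENNReal.ofReal (2 * β) := by
          gcongr with q _ i _ j _
          have := hξ.measure_exceedSet_le hσ hn hb0 (i * q) ((i + j) * q)
          rwa [hbsq] at this
      _ ≤ ∑ q ∈ Finset.Icc 1 n, ENNReal.ofReal (8 * M * (n * β) * (q : ℝ)⁻¹) := by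
          refine Finset.sum_le_sum fun q hq => ?_
          rw [Finset.mem_Icc] at hq
          have hq0 : (0 : ℝ) < q := by exact_mod_cast hq.1
          rw [Finset.sum_const, Finset.sum_const, Finset.card_range, Nat.card_Icc, nsmul_eq_mul,
            nsmul_eq_mul, Nat.add_sub_cancel, ← ENNReal.ofReal_natCast, ← ENNReal.ofReal_natCast,
            ← ENNReal.ofReal_mul (by positivity), ← ENNReal.ofReal_mul (by positivity)]
          refine ENNReal.ofReal_le_ofReal ?_
          have hdiv : ((n / q + 1 : ℕ) : ℝ) ≤ 2 * (n * (q : ℝ)⁻¹) := by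
            have e1 : ((n / q : ℕ) : ℝ) ≤ n / q := Nat.cast_div_le
            have e2 : (1 : ℝ) ≤ n / q := by
              rw [one_le_div hq0]; exact_mod_cast hq.2
            rw [← div_eq_mul_inv]; push_cast; linarith
          calc _ ≤ 2 * (n * (q : ℝ)⁻¹) * (((2 * M : ℕ) : ℝ) * (2 * β)) := by gcongr
            _ = _ := by push_cast; ring
      _ = ENNReal.ofReal (8 * M * (n * β) * ∑ q ∈ Finset.Icc 1 n, (q : ℝ)⁻¹) := by
          rw [← ENNReal.ofReal_sum_of_nonneg (fun q _ => by positivity), Finset.mul_sum]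
      _ ≤ _ := by
          refine ENNReal.ofReal_le_ofReal ?_
          have hh := harmonic_le_one_add_log n
          rw [harmonic_eq_sum_Icc] at hh
          push_cast at hh
          calc _ ≤ 8 * M * (n * β) * (1 + Real.log n) := by gcongr
            _ = _ := by ring
  refine (measure_mono hsub).trans ((measure_union_le _ _).trans ((add_le_add h1 h2).trans ?_))
  rw [← ENNReal.ofReal_add (by positivity) (by positivity)]
  refine ENNReal.ofReal_le_ofReal ?_
  have hγ : 0 ≤ (n : ℝ) ^ (-(1 + ρ / 2)) := by positivity
  have e1 : (n : ℝ) ^ 2 * α ≤ (n : ℝ) ^ (-(1 + ρ / 2)) := by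
    rw [hα, ← Real.rpow_natCast, ← Real.rpow_add hn0]
    refine Real.rpow_le_rpow_of_exponent_le hn1 ?_
    push_cast; linarith
  have e2 : (1 + Real.log n) * (n * β) ≤ (1 + 2 / ρ) * (n : ℝ) ^ (-(1 + ρ / 2)) := by
    have h3 : Real.log n ≤ (n : ℝ) ^ (ρ / 2) / (ρ / 2) := Real.log_le_rpow_div hn0.le (by positivity)
    have h4 : (1 : ℝ) ≤ (n : ℝ) ^ (ρ / 2) := Real.one_le_rpow hn1 (by positivity)
    have h5 : n * β = (n : ℝ) ^ (-(1 + ρ)) := by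
      rw [hβ]; nth_rewrite 1 [← Real.rpow_one (n : ℝ)]
      rw [← Real.rpow_add hn0]; congr 1; ring
    have h6 : (n : ℝ) ^ (-(1 + ρ / 2)) = (n : ℝ) ^ (ρ / 2) * (n : ℝ) ^ (-(1 + ρ)) := by
      rw [← Real.rpow_add hn0]; congr 1; ring
    rw [h5, h6, ← mul_assoc]
    gcongr
    calc 1 + Real.log n ≤ (n : ℝ) ^ (ρ / 2) + (n : ℝ) ^ (ρ / 2) / (ρ / 2) := by gcongr
      _ = _ := by field_simp
  have hM0 : (0 : ℝ) ≤ M := Nat.cast_nonneg M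
  nlinarith [mul_le_mul_of_nonneg_left e2 (by positivity : (0 : ℝ) ≤ 8 * M)]

/-- Exponential moments of the noise at the growing frequency `√(log n)`. -/
theorem IsNoise.lintegral_exp_le (hξ : IsNoise P σ ξ) {n : ℕ} (hn : 1 ≤ n) (i : Fin n) :
    ∫⁻ ω, ENNReal.ofReal (Real.exp (√(Real.log n) * |ξ n i ω|)) ∂P ≤
      ENNReal.ofReal (2 * (n : ℝ) ^ (σ ^ 2 / 2)) := by
  have hn0 : (0 : ℝ) < n := by exact_mod_cast hn
  have hlog : 0 ≤ Real.log n := Real.log_nonneg (by exact_mod_cast hn)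
  set u := √(Real.log n) with hu
  have hint := (hξ.subgaussian n i).integrable_exp_mul
  have hone : ∀ t : ℝ, t ^ 2 = Real.log n →
      ∫⁻ ω, ENNReal.ofReal (Real.exp (t * ξ n i ω)) ∂P ≤
        ENNReal.ofReal ((n : ℝ) ^ (σ ^ 2 / 2)) := by
    intro t ht
    rw [← ofReal_integral_eq_lintegral_ofReal (hint t) (ae_of_all _ fun ω => (Real.exp_pos _).le)]
    refine ENNReal.ofReal_le_ofReal (((hξ.subgaussian n i).mgf_le t).trans (le_of_eq ?_))
    rw [Real.coe_toNNReal _ (sq_nonneg σ), ht, Real.rpow_def_of_pos hn0]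
    congr 1; ring
  have hu2 : u ^ 2 = Real.log n := Real.sq_sqrt hlog
  have hm := hξ.meas n i
  calc _ ≤ ∫⁻ ω, (ENNReal.ofReal (Real.exp (u * ξ n i ω)) +
        ENNReal.ofReal (Real.exp (-u * ξ n i ω))) ∂P := by
        refine lintegral_mono fun ω => ?_
        rw [← ENNReal.ofReal_add (Real.exp_pos _).le (Real.exp_pos _).le]
        refine ENNReal.ofReal_le_ofReal ?_
        have h1 := Real.exp_pos (u * ξ n i ω)
        have h2 := Real.exp_pos (-u * ξ n i ω)
        rcases abs_cases (ξ n i ω) with ⟨h, -⟩ | ⟨h, -⟩ <;> rw [h]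
        · linarith
        · rw [mul_neg, ← neg_mul]; linarith
    _ = _ := lintegral_add_left (by fun_prop) _
    _ ≤ ENNReal.ofReal ((n : ℝ) ^ (σ ^ 2 / 2)) + ENNReal.ofReal ((n : ℝ) ^ (σ ^ 2 / 2)) :=
        add_le_add (hone u hu2) (hone (-u) (by rw [neg_sq, hu2]))
    _ = _ := by rw [← ENNReal.ofReal_add (by positivity) (by positivity), ← two_mul]

end Noise

/-! ### The upper bounds -/

theorem one_div_max_two {p : ℝ} (hp : 0 < p) : 1 / max p 2 = min (1 / 2) (1 / p) := by
  rcases le_total p 2 with h | h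
  · rw [max_eq_right h, min_eq_left (one_div_le_one_div_of_le hp h)]
  · rw [max_eq_left h, min_eq_right (one_div_le_one_div_of_le two_pos h)]

theorem invRate_pos {p : ℝ} {n k : ℕ} (hn : 1 ≤ n) : 0 < invRate p n k := by
  have hn0 : (0 : ℝ) < n := by exact_mod_cast hn
  exact Real.rpow_pos_of_pos (by positivity) _

theorem inv_invRate {p : ℝ} (hp : 0 < p) {n k : ℕ} :
    ((2 * k + 1 : ℝ) / n) ^ (1 / max p 2) = (invRate p n k)⁻¹ := by
  rw [invRate, one_div_max_two hp, ← Real.inv_rpow (by positivity), inv_div]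

theorem invRate_le_sqrt {p : ℝ} (hp : 0 < p) {n k : ℕ} (hn : 1 ≤ n) :
    invRate p n k ≤ (n : ℝ) ^ (1 / 2 : ℝ) := by
  have hn1 : (1 : ℝ) ≤ n := by exact_mod_cast hn
  have h0 : 0 ≤ min (1 / 2) (1 / p) := le_min (by norm_num) (by positivity)
  calc invRate p n k ≤ (n : ℝ) ^ min (1 / 2) (1 / p) := by
        refine Real.rpow_le_rpow (by positivity) (div_le_self (by positivity) ?_) h0
        linarith [(Nat.cast_nonneg k : (0 : ℝ) ≤ k)]
    _ ≤ _ := Real.rpow_le_rpow_of_exponent_le hn1 (min_le_left _ _)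

theorem ofReal_mul_le_of_le {l V G : ℝ} (hl : 0 < l) (hV : 0 < V) {x : ℝ≥0∞}
    (h : x ≤ ENNReal.ofReal (G * l * V⁻¹)) : ENNReal.ofReal (1 / l * V) * x ≤ ENNReal.ofReal G := by
  calc _ ≤ ENNReal.ofReal (1 / l * V) * ENNReal.ofReal (G * l * V⁻¹) := by gcongr
    _ = ENNReal.ofReal G := by
      rw [← ENNReal.ofReal_mul (by positivity)]; congr 1; field_simp

theorem rpow_le_factorial_mul_exp {x : ℝ} (hx : 1 ≤ x) {r : ℝ} {m : ℕ} (hm : r ≤ m) :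
    x ^ r ≤ m.factorial * Real.exp x := by
  calc x ^ r ≤ x ^ (m : ℝ) := Real.rpow_le_rpow_of_exponent_le hx hm
    _ = x ^ m := Real.rpow_natCast _ _
    _ ≤ _ := by
      have := Real.pow_div_factorial_le_exp (x := x) (by linarith) m
      rw [div_le_iff₀ (by positivity)] at this
      linarith

theorem one_le_sqrt_log {n : ℕ} (hn : 3 ≤ n) : 1 ≤ √(Real.log n) := by
  rw [Real.one_le_sqrt, Real.le_log_iff_exp_le (by exact_mod_cast (by omega : 0 < n))]
  have : (3 : ℝ) ≤ n := by exact_mod_cast hn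
  linarith [Real.exp_one_lt_three]

/-- The part of `E (A λ + max |ξ|)^r` off the event `NoiseBound` that is due to exceptionally large
noise, in pointwise form: here `z` is the maximum of the noise, `l = √(log n)`, and
`exp (-D l²) = n^{-D}` is the gain from Markov's inequality at the frequency `l`. -/
theorem rpow_add_le {A D z l r : ℝ} {m : ℕ} (hA : 1 ≤ A) (hz : 0 ≤ z) (hl : 1 ≤ l)
    (hm : r ≤ m) (hDz : D * l ≤ z) :
    (A * l + z) ^ r ≤
      l ^ r * (m.factorial * Real.exp (A + D) * Real.exp (-D * l ^ 2)) * Real.exp (l * z) := by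
  have hl0 : 0 < l := by linarith
  set w := z / l with hw
  have hzw : z = w * l := by rw [hw]; field_simp
  have hw0 : 0 ≤ w := by positivity
  have hDw : D ≤ w := by rw [hw, le_div_iff₀ hl0]; exact hDz
  have h1 : (A * l + z) ^ r = l ^ r * (A + w) ^ r := by
    rw [← Real.mul_rpow hl0.le (by linarith)]; congr 1; rw [hzw]; ring
  rw [h1, mul_assoc]
  refine mul_le_mul_of_nonneg_left ?_ (by positivity)
  refine (rpow_le_factorial_mul_exp (by linarith) hm).trans ?_
  rw [mul_assoc, mul_assoc, ← Real.exp_add, ← Real.exp_add]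
  refine mul_le_mul_of_nonneg_left (Real.exp_le_exp.2 ?_) (by positivity)
  rw [hzw]
  nlinarith [mul_nonneg (sub_nonneg.2 hDw) (by nlinarith : (0 : ℝ) ≤ l ^ 2 - 1)]

section Upper

variable {Ω : Type*} [MeasurableSpace Ω] {P : Measure Ω} {σ : ℝ} {ξ : (n : ℕ) → Fin n → Ω → ℝ}
  {p r L c δ a : ℝ}

/-- On the event `NoiseBound` the segmentation attains the rate, simultaneously for all signals. -/
theorem lpDist_le_of_noiseBound (hp : 0 < p) (hL : 0 < L) (hc : 1 < c) (hδ : 0 < δ) (ha : δ ≤ a)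
    {n : ℕ} (hn : 3 ≤ n) {S : Set (ℝ × ℝ)} (hS : IsNormalSystem c n S)
    {s : (ℝ → ℝ) → ℝ × ℝ → ℝ} (hs : ∀ g, ∀ I ∈ S, |s g I| ≤ δ * √(Real.log n))
    {k : ℕ} {f g : ℝ → ℝ} (hf : f ∈ boundedSteps L k) {e : Fin n → ℝ}
    (he : NoiseBound n ((a - δ) * √(Real.log n)) e)
    (hg : IsSegmentation n S s (a * √(Real.log n)) (data n f e) g) :
    lpDist p g f ≤
      ENNReal.ofReal (3 * (2 * a * √c + 2 * L) * √(Real.log n) * (invRate p n k)⁻¹) := by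
  have hl := one_le_sqrt_log hn
  set l := √(Real.log n)
  obtain ⟨j, hj, hmin⟩ := hg
  obtain ⟨⟨k', hk', hfs⟩, -⟩ := id hf
  obtain ⟨j', hj', g', hg'⟩ := exists_isFeasible (by omega) hS hs
    (η := a * l) (B := (a - δ) * l) (le_of_eq (by ring)) hfs he
  have hjk : j ≤ 2 * k := (hmin _ _ hg').trans (by omega)
  have h0 : 0 ≤ a * l := mul_nonneg (by linarith) (by linarith)
  have hinv : 0 ≤ (invRate p n k)⁻¹ := (inv_pos.2 (invRate_pos (by omega))).le
  refine (hj.lpDist_le (p := p) (by omega) hc hS hL.le hs (by nlinarith) he hjk hf).trans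
    (ENNReal.ofReal_le_ofReal ?_)
  rw [inv_invRate hp]
  refine mul_le_mul_of_nonneg_right ?_ hinv
  have : a * l + δ * l + (a - δ) * l = 2 * a * l := by ring
  rw [this]
  nlinarith [Real.sqrt_nonneg c]

theorem tsum_measure_not_noiseBound_ne_top [IsProbabilityMeasure P] (hξ : IsNoise P σ ξ) (hσ : 0 < σ) {ρ B : ℝ}
    (hρ : 0 < ρ) (hB : σ * √(2 * ρ + 4) < B) :
    ∑' n : ℕ, P {ω | ¬ NoiseBound n (B * √(Real.log n)) fun i => ξ n i ω} ≠ ∞ := by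
  obtain ⟨C, hC, h⟩ := hξ.measure_not_noiseBound_le hσ hρ hB
  have hsum : Summable fun n : ℕ => C * (n : ℝ) ^ (-(1 + ρ / 2)) :=
    (Real.summable_nat_rpow.2 (by linarith)).mul_left C
  refine ne_top_of_le_ne_top hsum.tsum_ofReal_ne_top (ENNReal.tsum_le_tsum fun n => ?_)
  rcases Nat.eq_zero_or_pos n with rfl | hn
  · have : {ω | ¬ NoiseBound 0 (B * √(Real.log (0 : ℕ))) fun i => ξ 0 i ω} = ∅ :=
      Set.eq_empty_of_forall_notMem fun ω hω => hω fun a b hab hb => by omega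
    rw [this, measure_empty]
    exact zero_le
  · exact h n hn

theorem ae_limsup_lt_top [IsProbabilityMeasure P] (hσ : 0 < σ) (hξ : IsNoise P σ ξ)
    (hp : 0 < p) (hr : 0 < r) (hL : 0 < L) (k : ℕ → ℕ) (hc : 1 < c) (hδ : 0 < δ)
    (ha : δ + σ * √(2 * r + 4) < a) {S : ℕ → Set (ℝ × ℝ)}
    {s : (n : ℕ) → Ω → (Fin n → ℝ) → (ℝ → ℝ) → ℝ × ℝ → ℝ}
    {fhat : (n : ℕ) → Ω → (Fin n → ℝ) → ℝ → ℝ}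
    (hE : IsMultiscaleEstimator P c δ (fun n : ℕ => a * √(Real.log n)) S s fhat) :
    ∀ᵐ ω ∂P, limsup (fun n : ℕ => ENNReal.ofReal (1 / √(Real.log n) * invRate p n (k n)) *
      ⨆ f ∈ boundedSteps L (k n), lpDist p (fhat n ω (data n f fun i => ξ n i ω)) f) atTop < ∞ := by
  have h1 := ae_eventually_notMem (tsum_measure_not_noiseBound_ne_top hξ hσ hr (B := a - δ) (by linarith))
  have h2 : ∀ᵐ ω ∂P, ∀ n, 1 ≤ n → ∀ y g, ∀ I ∈ S n, |s n ω y g I| ≤ δ * √(Real.log n) := by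
    rw [ae_all_iff]; intro n
    by_cases hn : 1 ≤ n
    · filter_upwards [hE.penalty n hn] with ω hω _ using hω
    · exact ae_of_all _ fun ω h => absurd h hn
  have h3 : ∀ᵐ ω ∂P, ∀ n, 1 ≤ n → ∀ y,
      IsSegmentation n (S n) (s n ω y) (a * √(Real.log n)) y (fhat n ω y) := by
    rw [ae_all_iff]; intro n
    by_cases hn : 1 ≤ n
    · filter_upwards [hE.solution n hn] with ω hω _ using hω
    · exact ae_of_all _ fun ω h => absurd h hn
  have hδa : δ ≤ a := by nlinarith [Real.sqrt_nonneg (2 * r + 4)]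
  filter_upwards [h1, h2, h3] with ω hω1 hω2 hω3
  refine lt_of_le_of_lt (limsup_le_of_le (by isBoundedDefault) ?_)
    (ENNReal.ofReal_lt_top (r := 3 * (2 * a * √c + 2 * L)))
  filter_upwards [hω1, eventually_ge_atTop 3] with n hn1 hn3
  have hl := one_le_sqrt_log hn3
  refine ofReal_mul_le_of_le (by linarith) (invRate_pos (by omega)) ?_
  refine iSup₂_le fun f hf => ?_
  exact lpDist_le_of_noiseBound hp hL hc hδ hδa hn3 (hE.normal n (by omega))
    (hω2 n (by omega) _) hf (by simpa using hn1) (hω3 n (by omega) _)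

theorem limsup_risk_lt_top [IsProbabilityMeasure P] (hσ : 0 < σ) (hξ : IsNoise P σ ξ)
    (hp : 0 < p) (hr : 0 < r) (hL : 0 < L) (k : ℕ → ℕ) (hc : 1 < c) (hδ : 0 < δ)
    (ha : δ + σ * √(2 * r + 4) < a) {S : ℕ → Set (ℝ × ℝ)}
    {s : (n : ℕ) → Ω → (Fin n → ℝ) → (ℝ → ℝ) → ℝ × ℝ → ℝ}
    {fhat : (n : ℕ) → Ω → (Fin n → ℝ) → ℝ → ℝ}
    (hE : IsMultiscaleEstimator P c δ (fun n : ℕ => a * √(Real.log n)) S s fhat) :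
    limsup (fun n : ℕ => ENNReal.ofReal (1 / √(Real.log n) * invRate p n (k n)) *
      ⨆ f ∈ boundedSteps L (k n), risk P p r n (ξ n) (fhat n) f) atTop < ∞ := by
  have hδa : δ ≤ a := by nlinarith [Real.sqrt_nonneg (2 * r + 4)]
  obtain ⟨C, hC, hbad⟩ := hξ.measure_not_noiseBound_le hσ hr (B := a - δ) (by linarith)
  obtain ⟨m, hm⟩ := exists_nat_ge r
  set G := 3 * (2 * a * √c + 2 * L) with hG
  set A := a + δ + 2 * L + 1 with hA
  -- This `D` makes `n * n ^ (-D) * n ^ (σ ^ 2 / 2)` equal to `n ^ (-r / 2)`.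
  set D := 1 + σ ^ 2 / 2 + r / 2 with hD
  set E := (m.factorial : ℝ) * Real.exp (A + D) with hEdef
  set H := G ^ r + ((A + D) ^ r * C + E * 2) with hH
  have ha0 : 0 < a := by linarith
  have hG0 : 0 ≤ G := by positivity
  have hA1 : 1 ≤ A := by linarith
  have hD0 : 0 < D := by positivity
  have hE0 : 0 ≤ E := by positivity
  have hH0 : 0 ≤ H := by positivity
  refine lt_of_le_of_lt (limsup_le_of_le (by isBoundedDefault) ?_)
    (ENNReal.ofReal_lt_top (r := H ^ (1 / r)))
  filter_upwards [eventually_ge_atTop 3] with n hn3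
  have hn1 : 1 ≤ n := by omega
  have hl := one_le_sqrt_log hn3
  have hn0 : (0 : ℝ) < n := by exact_mod_cast hn1
  have hl2 : √(Real.log n) ^ 2 = Real.log n :=
    Real.sq_sqrt (Real.log_nonneg (by exact_mod_cast hn1))
  have hV := invRate_pos (p := p) (k := k n) hn1
  refine ofReal_mul_le_of_le (by linarith) hV ?_
  refine iSup₂_le fun f hf => ?_
  have hexp := fun i => hξ.lintegral_exp_le (P := P) hn1 i
  have hbadn := hbad n hn1
  have hpen := hE.penalty n hn1
  have hsol := hE.solution n hn1
  set l := √(Real.log n) with hldef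
  have hl0 : 0 < l := by linarith
  set V := (invRate p n (k n))⁻¹ with hVdef
  have hV0 : 0 < V := inv_pos.2 hV
  set bad := toMeasurable P {ω | ¬ NoiseBound n ((a - δ) * l) fun i => ξ n i ω} with hbaddef
  have hbadm : MeasurableSet bad := measurableSet_toMeasurable _ _
  have hnD : Real.exp (-D * l ^ 2) = (n : ℝ) ^ (-D) := by
    rw [hl2, Real.rpow_def_of_pos hn0, mul_comm]
  have hpt : ∀ᵐ ω ∂P, lpDist p (fhat n ω (data n f fun i => ξ n i ω)) f ^ r ≤
      ENNReal.ofReal ((G * l * V) ^ r) +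
        (bad.indicator (fun _ => ENNReal.ofReal (l ^ r * (A + D) ^ r)) ω +
          ENNReal.ofReal (l ^ r * (E * (n : ℝ) ^ (-D))) *
            ∑ i, ENNReal.ofReal (Real.exp (l * |ξ n i ω|))) := by
    filter_upwards [hpen, hsol] with ω hω1 hω2
    by_cases hnb : NoiseBound n ((a - δ) * l) fun i => ξ n i ω
    · refine le_add_right ?_
      rw [← ENNReal.ofReal_rpow_of_nonneg (by positivity) hr.le]
      refine ENNReal.rpow_le_rpow ?_ hr.le
      exact lpDist_le_of_noiseBound hp hL hc hδ hδa hn3 (hE.normal n hn1) (hω1 _) hf hnb (hω2 _)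
    · refine le_add_left ?_
      have hωbad : ω ∈ bad := subset_toMeasurable _ _ hnb
      rw [Set.indicator_of_mem hωbad]
      have : Nonempty (Fin n) := ⟨⟨0, by omega⟩⟩
      obtain ⟨i₀, hi₀⟩ := Finite.exists_max fun i => |ξ n i ω|
      obtain ⟨j, hj, -⟩ := hω2 (data n f fun i => ξ n i ω)
      have h1 := hj.lpDist_le_crude (p := p) hn1 (hE.normal n hn1) hL.le (by positivity)
        (abs_nonneg (ξ n i₀ ω)) (hω1 _) hi₀ hf
      have h2 : lpDist p (fhat n ω (data n f fun i => ξ n i ω)) f ≤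
          ENNReal.ofReal (A * l + |ξ n i₀ ω|) := by
        refine h1.trans (ENNReal.ofReal_le_ofReal ?_)
        nlinarith
      have h3 := ENNReal.rpow_le_rpow h2 hr.le
      rw [ENNReal.ofReal_rpow_of_nonneg (by positivity) hr.le] at h3
      refine h3.trans ?_
      rcases le_total |ξ n i₀ ω| (D * l) with hle | hle
      · refine le_add_right (ENNReal.ofReal_le_ofReal ?_)
        rw [← Real.mul_rpow hl0.le (by positivity)]
        refine Real.rpow_le_rpow (by positivity) ?_ hr.le
        linarith
      · refine le_add_left ?_
        refine (ENNReal.ofReal_le_ofReal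
          (rpow_add_le hA1 (abs_nonneg _) hl hm hle)).trans ?_
        rw [hnD, ENNReal.ofReal_mul (by positivity)]
        gcongr
        exact Finset.single_le_sum
          (f := fun i => ENNReal.ofReal (Real.exp (l * |ξ n i ω|))) (fun _ _ => zero_le)
          (Finset.mem_univ i₀)
  have hmeas := hξ.meas n
  have hnr : (n : ℝ) ^ (-(r / 2)) ≤ V ^ r := by
    have h1 : (n : ℝ) ^ (-(1 / 2) : ℝ) ≤ V := by
      rw [Real.rpow_neg hn0.le]
      exact inv_anti₀ hV (invRate_le_sqrt hp hn1)
    calc (n : ℝ) ^ (-(r / 2)) = ((n : ℝ) ^ (-(1 / 2) : ℝ)) ^ r := by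
          rw [← Real.rpow_mul hn0.le]; congr 1; ring
      _ ≤ V ^ r := Real.rpow_le_rpow (by positivity) h1 hr.le
  have hint : ∫⁻ ω, lpDist p (fhat n ω (data n f fun i => ξ n i ω)) f ^ r ∂P ≤
      ENNReal.ofReal ((H ^ (1 / r) * l * V) ^ r) := by
    refine (lintegral_mono_ae hpt).trans ?_
    rw [lintegral_add_left measurable_const,
      lintegral_add_left (measurable_const.indicator hbadm), lintegral_const, measure_univ, mul_one,
      lintegral_indicator_const hbadm, lintegral_const_mul _ (by fun_prop),
      lintegral_finsetSum _ (fun i _ => by fun_prop), hbaddef, measure_toMeasurable]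
    calc _ ≤ ENNReal.ofReal ((G * l * V) ^ r) + (ENNReal.ofReal (l ^ r * (A + D) ^ r) *
          ENNReal.ofReal (C * (n : ℝ) ^ (-(1 + r / 2))) +
          ENNReal.ofReal (l ^ r * (E * (n : ℝ) ^ (-D))) *
            ∑ i : Fin n, ENNReal.ofReal (2 * (n : ℝ) ^ (σ ^ 2 / 2))) := by
          gcongr with i _
          exact hexp i
      _ = ENNReal.ofReal ((G * l * V) ^ r + (l ^ r * (A + D) ^ r * (C * (n : ℝ) ^ (-(1 + r / 2))) +
          l ^ r * (E * (n : ℝ) ^ (-D)) * (n * (2 * (n : ℝ) ^ (σ ^ 2 / 2))))) := by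
          rw [Finset.sum_const, Finset.card_univ, Fintype.card_fin, nsmul_eq_mul,
            ← ENNReal.ofReal_natCast, ← ENNReal.ofReal_mul (by positivity),
            ← ENNReal.ofReal_mul (by positivity), ← ENNReal.ofReal_mul (by positivity),
            ← ENNReal.ofReal_add (by positivity) (by positivity),
            ← ENNReal.ofReal_add (by positivity) (by positivity)]
      _ ≤ _ := by
          refine ENNReal.ofReal_le_ofReal ?_
          have e1 : (n : ℝ) ^ (-(1 + r / 2)) ≤ V ^ r :=
            (Real.rpow_le_rpow_of_exponent_le (by exact_mod_cast hn1) (by linarith)).trans hnr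
          have e2 : (n : ℝ) ^ (-D) * (n * (n : ℝ) ^ (σ ^ 2 / 2)) ≤ V ^ r := by
            refine le_trans (le_of_eq ?_) hnr
            nth_rewrite 2 [← Real.rpow_one (n : ℝ)]
            rw [← Real.rpow_add hn0, ← Real.rpow_add hn0, hD]
            congr 1; ring
          have e3 : (H ^ (1 / r) * l * V) ^ r = l ^ r * (H * V ^ r) := by
            rw [Real.mul_rpow (by positivity) hV0.le, Real.mul_rpow (by positivity) hl0.le,
              ← Real.rpow_mul hH0, one_div_mul_cancel hr.ne', Real.rpow_one]
            ring
          have e4 : (G * l * V) ^ r = l ^ r * (G ^ r * V ^ r) := by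
            rw [Real.mul_rpow (by positivity) hV0.le, Real.mul_rpow (by positivity) hl0.le]
            ring
          rw [e3, e4, hH]
          calc _ = l ^ r * (G ^ r * V ^ r + ((A + D) ^ r * C * (n : ℝ) ^ (-(1 + r / 2)) +
                E * 2 * ((n : ℝ) ^ (-D) * (n * (n : ℝ) ^ (σ ^ 2 / 2))))) := by ring
            _ ≤ l ^ r * (G ^ r * V ^ r + ((A + D) ^ r * C * V ^ r + E * 2 * V ^ r)) := by
                gcongr
            _ = _ := by ring
  calc risk P p r n (ξ n) (fhat n) f
      ≤ (ENNReal.ofReal ((H ^ (1 / r) * l * V) ^ r)) ^ (1 / r) :=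
        ENNReal.rpow_le_rpow hint (by positivity)
    _ = _ := by
        rw [ENNReal.ofReal_rpow_of_nonneg (by positivity) (by positivity),
          ← Real.rpow_mul (by positivity), mul_one_div_cancel hr.ne', Real.rpow_one]

end Upper

/-! ### Testing two shifts of the noise -/

/-- Tonelli's theorem for products of functions of one coordinate. -/
theorem lintegral_fin_prod_eq_prod {n : ℕ} {μ : Fin n → Measure ℝ} [∀ i, SigmaFinite (μ i)]
    {f : Fin n → ℝ → ℝ≥0∞} (hf : ∀ i, Measurable (f i)) :
    ∫⁻ x, ∏ i, f i (x i) ∂(Measure.pi μ) = ∏ i, ∫⁻ x, f i x ∂(μ i) := by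
  induction n with
  | zero => simp
  | succ n ih =>
    have hm : Measurable fun x : Fin n → ℝ => ∏ i : Fin n, f i.succ (x i) :=
      Finset.measurable_fun_prod _ fun i _ => (hf i.succ).comp (measurable_pi_apply i)
    calc _ = ∫⁻ x : ℝ × (Fin n → ℝ), f 0 x.1 * ∏ i : Fin n, f (Fin.succ i) (x.2 i)
            ∂((μ 0).prod (Measure.pi (fun i ↦ μ i.succ))) := by
          rw [← ((measurePreserving_piFinSuccAbove μ 0).symm).lintegral_comp_emb
            (MeasurableEquiv.measurableEmbedding _)]
          simp_rw [MeasurableEquiv.piFinSuccAbove_symm_apply, Fin.insertNthEquiv,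
            Fin.prod_univ_succ, Fin.insertNth_zero, Equiv.coe_fn_mk, Fin.cons_succ,
            Fin.zero_succAbove, Fin.cons_zero]
          rfl
      _ = (∫⁻ x, f 0 x ∂μ 0) * ∏ i : Fin n, ∫⁻ x, f (Fin.succ i) x ∂(μ i.succ) := by
          rw [← ih fun i => hf i.succ, ← lintegral_prod_mul (hf 0).aemeasurable hm.aemeasurable]
      _ = ∏ i, ∫⁻ x, f i x ∂(μ i) := by rw [Fin.prod_univ_succ]

theorem pi_withDensity {n : ℕ} {f : Fin n → ℝ → ℝ≥0∞} (hf : ∀ i, Measurable (f i))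
    [∀ i, SigmaFinite (volume.withDensity (f i))] :
    Measure.pi (fun i => volume.withDensity (f i)) =
      (volume : Measure (Fin n → ℝ)).withDensity fun x => ∏ i, f i (x i) := by
  refine Measure.pi_eq fun s hs => ?_
  rw [withDensity_apply _ (MeasurableSet.univ_pi hs),
    ← lintegral_indicator (MeasurableSet.univ_pi hs)]
  have h : ∀ x : Fin n → ℝ, (Set.univ.pi s).indicator (fun x => ∏ i, f i (x i)) x =
      ∏ i, (s i).indicator (f i) (x i) := by
    intro x
    classical
    by_cases hx : x ∈ Set.univ.pi s
    · rw [Set.indicator_of_mem hx]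
      exact Finset.prod_congr rfl fun i _ => (Set.indicator_of_mem (hx i trivial) _).symm
    · rw [Set.indicator_of_notMem hx]
      simp only [Set.mem_pi, Set.mem_univ, true_imp_iff, not_forall] at hx
      obtain ⟨i, hi⟩ := hx
      exact (Finset.prod_eq_zero (Finset.mem_univ i) (Set.indicator_of_notMem hi _)).symm
  simp_rw [h]
  rw [volume_pi, lintegral_fin_prod_eq_prod fun i => (hf i).indicator (hs i)]
  refine Finset.prod_congr rfl fun i _ => ?_
  rw [lintegral_indicator (hs i), withDensity_apply _ (hs i)]

theorem ofReal_integral_le_lintegral {α : Type*} [MeasurableSpace α] {μ : Measure α} {f : α → ℝ}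
    (hf : Integrable f μ) : ENNReal.ofReal (∫ x, f x ∂μ) ≤ ∫⁻ x, ENNReal.ofReal (f x) ∂μ := by
  rw [integral_eq_lintegral_pos_part_sub_lintegral_neg_part hf]
  exact (ENNReal.ofReal_le_ofReal (sub_le_self _ ENNReal.toReal_nonneg)).trans
    ENNReal.ofReal_toReal_le

/-- The Hellinger affinity of a density and its shift is at least `exp (-KL / 2)`, by Jensen's
inequality for the exponential function. -/
theorem ShiftKLLe.exp_le_affinity {φ : ℝ → ℝ} {z B : ℝ} (hφ : Measurable φ) (h0 : ∀ x, 0 ≤ φ x)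
    (h1 : ∫⁻ x, ENNReal.ofReal (φ x) = 1) (h : ShiftKLLe φ z B) :
    ENNReal.ofReal (Real.exp (-(B / 2))) ≤
      ∫⁻ x, (ENNReal.ofReal (φ x) * ENNReal.ofReal (φ (x + z))) ^ (1 / 2 : ℝ) := by
  obtain ⟨hac, hint, hB⟩ := h
  have hφint : Integrable φ :=
    ⟨hφ.aestronglyMeasurable, by
      rw [hasFiniteIntegral_iff_ofReal (ae_of_all _ h0), h1]; exact ENNReal.one_lt_top⟩
  have hφ1 : ∫ x, φ x = 1 := by
    rw [integral_eq_lintegral_of_nonneg_ae (ae_of_all _ h0) hφ.aestronglyMeasurable, h1,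
      ENNReal.toReal_one]
  set M := ∫ x, φ x * Real.log (φ x / φ (x + z)) with hM
  -- `u` is a minorant of the affinity integrand `φ exp (-log (φ / φ(· + z)) / 2)`: the exponential
  -- function is replaced by its tangent at `-M / 2`.
  let u : ℝ → ℝ := fun x => Real.exp (-(M / 2)) *
    ((1 + M / 2) * φ x - φ x * Real.log (φ x / φ (x + z)) / 2)
  have huint : Integrable u := ((hφint.const_mul _).sub (hint.div_const _)).const_mul _
  have hu : ∫ x, u x = Real.exp (-(M / 2)) := by
    simp only [u]
    rw [integral_const_mul, integral_sub (hφint.const_mul _) (hint.div_const _),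
      integral_const_mul, hφ1, integral_div, ← hM]
    ring
  calc ENNReal.ofReal (Real.exp (-(B / 2))) ≤ ENNReal.ofReal (∫ x, u x) := by
        rw [hu]; gcongr
    _ ≤ ∫⁻ x, ENNReal.ofReal (u x) := ofReal_integral_le_lintegral huint
    _ ≤ _ := by
        refine lintegral_mono_ae ?_
        filter_upwards [hac] with x hx
        rw [← ENNReal.ofReal_mul (h0 x),
          ENNReal.ofReal_rpow_of_nonneg (mul_nonneg (h0 x) (h0 _)) (by norm_num)]
        refine ENNReal.ofReal_le_ofReal ?_
        rcases (h0 x).eq_or_lt with hzero | hpos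
        · simp only [u, ← hzero]; simp
        have hpos' : 0 < φ (x + z) :=
          lt_of_le_of_ne (h0 _) fun h => hpos.ne' (hx h.symm)
        set l := Real.log (φ x / φ (x + z)) with hl
        have e1 : (φ x * φ (x + z)) ^ (1 / 2 : ℝ) = φ x * Real.exp (-(l / 2)) := by
          have : φ x * φ (x + z) = φ x ^ 2 * Real.exp (-l) := by
            rw [hl, Real.exp_neg, Real.exp_log (by positivity)]; field_simp
          rw [this, ← Real.sqrt_eq_rpow, Real.sqrt_mul (sq_nonneg _), Real.sqrt_sq hpos.le,
            Real.sqrt_eq_rpow, ← Real.exp_mul]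
          congr 2; ring
        have e2 : Real.exp (-(l / 2)) = Real.exp (-(M / 2)) * Real.exp (M / 2 - l / 2) := by
          rw [← Real.exp_add]; congr 1; ring
        have e3 := Real.add_one_le_exp (M / 2 - l / 2)
        rw [e1, e2]
        calc u x = φ x * (Real.exp (-(M / 2)) * (M / 2 - l / 2 + 1)) := by simp only [u]; ring
          _ ≤ _ := by gcongr

/-- Two densities with a large Hellinger affinity overlap. -/
theorem affinity_sq_le {α : Type*} [MeasurableSpace α] {μ : Measure α} {p q : α → ℝ≥0∞}
    (hp : Measurable p) (hq : Measurable q) (hp1 : ∫⁻ x, p x ∂μ = 1) (hq1 : ∫⁻ x, q x ∂μ = 1) :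
    (∫⁻ x, (p x * q x) ^ (1 / 2 : ℝ) ∂μ) ^ (2 : ℝ) ≤ 2 * ∫⁻ x, min (p x) (q x) ∂μ := by
  have hmin : Measurable fun x => min (p x) (q x) := hp.min hq
  have hmax : Measurable fun x => max (p x) (q x) := hp.max hq
  have h1 := ENNReal.lintegral_mul_le_Lp_mul_Lq μ Real.HolderConjugate.two_two
    (hmin.pow_const (1 / 2 : ℝ)).aemeasurable (hmax.pow_const (1 / 2 : ℝ)).aemeasurable
  have h2 : ∀ y : ℝ≥0∞, (y ^ (1 / 2 : ℝ)) ^ (2 : ℝ) = y := fun y => by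
    rw [← ENNReal.rpow_mul]; norm_num
  simp only [Pi.mul_apply, h2] at h1
  have h3 : ∀ x, min (p x) (q x) ^ (1 / 2 : ℝ) * max (p x) (q x) ^ (1 / 2 : ℝ) =
      (p x * q x) ^ (1 / 2 : ℝ) := fun x => by
    rw [← ENNReal.mul_rpow_of_nonneg _ _ (by norm_num), min_mul_max]
  simp only [h3] at h1
  have h4 : ∫⁻ x, max (p x) (q x) ∂μ ≤ 2 := by
    calc _ ≤ ∫⁻ x, (p x + q x) ∂μ := lintegral_mono fun x => max_le le_self_add le_add_self
      _ = 2 := by rw [lintegral_add_left hp, hp1, hq1]; norm_num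
  calc _ ≤ ((∫⁻ x, min (p x) (q x) ∂μ) ^ (1 / 2 : ℝ) *
        (∫⁻ x, max (p x) (q x) ∂μ) ^ (1 / 2 : ℝ)) ^ (2 : ℝ) := by gcongr
    _ = (∫⁻ x, min (p x) (q x) ∂μ) * ∫⁻ x, max (p x) (q x) ∂μ := by
        rw [ENNReal.mul_rpow_of_nonneg _ _ (by norm_num), h2, h2]
    _ ≤ _ := by rw [mul_comm]; gcongr

section Density

variable {Ω : Type*} [MeasurableSpace Ω] {P : Measure Ω} {σ : ℝ} {ξ : (n : ℕ) → Fin n → Ω → ℝ}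
  {φ : (n : ℕ) → Fin n → ℝ → ℝ}

theorem HasNoiseDensity.lintegral_eq_one [IsProbabilityMeasure P] (hξ : IsNoise P σ ξ)
    (hd : HasNoiseDensity P ξ φ) (n : ℕ) (i : Fin n) : ∫⁻ x, ENNReal.ofReal (φ n i x) = 1 := by
  have := Measure.isProbabilityMeasure_map (μ := P) (hξ.meas n i).aemeasurable
  have h : (P.map (ξ n i)) Set.univ = 1 := measure_univ
  rwa [hd.law n i, withDensity_apply _ MeasurableSet.univ, Measure.restrict_univ] at h

/-- The data `v + ξ` have the product density `∏ φ i (y i - v i)`. -/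
theorem HasNoiseDensity.lintegral_shift [IsProbabilityMeasure P] (hξ : IsNoise P σ ξ)
    (hd : HasNoiseDensity P ξ φ) (n : ℕ) (v : Fin n → ℝ) {F : (Fin n → ℝ) → ℝ≥0∞}
    (hF : Measurable F) :
    ∫⁻ ω, F (fun i => v i + ξ n i ω) ∂P =
      ∫⁻ y, (∏ i, ENNReal.ofReal (φ n i (y i - v i))) * F y := by
  have hm := hξ.meas n
  have hφ := hd.meas n
  have hφv : ∀ i, Measurable fun x => ENNReal.ofReal (φ n i (x - v i)) := fun i => by fun_prop
  have hlaw : ∀ i, P.map (fun ω => v i + ξ n i ω) =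
      volume.withDensity fun x => ENNReal.ofReal (φ n i (x - v i)) := by
    intro i
    ext s hs
    rw [withDensity_apply _ hs]
    have h1 : P.map (fun ω => v i + ξ n i ω) = (P.map (ξ n i)).map (fun x => v i + x) := by
      rw [Measure.map_map (by fun_prop) (hm i)]; rfl
    rw [h1, hd.law, Measure.map_apply (by fun_prop) hs,
      withDensity_apply _ (hs.preimage (by fun_prop)), ← lintegral_indicator hs,
      ← lintegral_indicator (hs.preimage (by fun_prop)), ← lintegral_add_left_eq_self
        (s.indicator fun x => ENNReal.ofReal (φ n i (x - v i))) (v i)]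
    refine lintegral_congr fun x => ?_
    by_cases hx : v i + x ∈ s
    · rw [Set.indicator_of_mem hx, Set.indicator_of_mem (by exact hx), add_sub_cancel_left]
    · rw [Set.indicator_of_notMem hx, Set.indicator_of_notMem (by exact hx)]
  have hsf : ∀ i, SigmaFinite
      (volume.withDensity fun x => ENNReal.ofReal (φ n i (x - v i))) := by
    intro i
    rw [← hlaw i]
    have := Measure.isProbabilityMeasure_map (μ := P) (f := fun ω => v i + ξ n i ω) (by fun_prop)
    infer_instance
  have hjoint : P.map (fun ω i => v i + ξ n i ω) =
      volume.withDensity fun y : Fin n → ℝ => ∏ i, ENNReal.ofReal (φ n i (y i - v i)) := by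
    have hi : iIndepFun (fun i ω => v i + ξ n i ω) P :=
      (hξ.indep n).comp (fun i x => v i + x) fun i => by fun_prop
    rw [(iIndepFun_iff_map_fun_eq_pi_map fun i => by fun_prop).1 hi]
    simp_rw [hlaw]
    rw [pi_withDensity hφv]
  have hdm : Measurable fun y : Fin n → ℝ => ∏ i, ENNReal.ofReal (φ n i (y i - v i)) :=
    Finset.measurable_fun_prod _ fun i _ => (hφv i).comp (measurable_pi_apply i)
  rw [← lintegral_map (f := F) hF (by fun_prop), hjoint,
    lintegral_withDensity_eq_lintegral_mul _ hdm hF]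
  rfl

/-- Two mean vectors at a bounded distance, in the metric of the Kullback–Leibler bounds, cannot be
told apart: no estimate has a small risk under both, once its losses add up to `d`. -/
theorem HasNoiseDensity.le_add_risk [IsProbabilityMeasure P] (hξ : IsNoise P σ ξ)
    (hd : HasNoiseDensity P ξ φ) {n : ℕ} {σ₀ z₀ C : ℝ}
    (hKL : ∀ i z, |z| ≤ z₀ → ShiftKLLe (φ n i) z (z ^ 2 / σ₀ ^ 2)) {v w : Fin n → ℝ}
    (hz : ∀ i, |v i - w i| ≤ z₀) (hC : ∑ i, (v i - w i) ^ 2 / σ₀ ^ 2 ≤ C)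
    {F G : (Fin n → ℝ) → ℝ≥0∞} (hF : Measurable F) (hG : Measurable G) {d : ℝ≥0∞}
    (hFG : ∀ y, d ≤ F y + G y) :
    ENNReal.ofReal (Real.exp (-C) / 2) * d ≤
      ∫⁻ ω, F (fun i => v i + ξ n i ω) ∂P + ∫⁻ ω, G (fun i => w i + ξ n i ω) ∂P := by
  have hφ := hd.meas n
  rw [hd.lintegral_shift hξ n v hF, hd.lintegral_shift hξ n w hG]
  set p : (Fin n → ℝ) → ℝ≥0∞ := fun y => ∏ i, ENNReal.ofReal (φ n i (y i - v i)) with hp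
  set q : (Fin n → ℝ) → ℝ≥0∞ := fun y => ∏ i, ENNReal.ofReal (φ n i (y i - w i)) with hq
  have hdens : ∀ v : Fin n → ℝ,
      Measurable fun y : Fin n → ℝ => ∏ i, ENNReal.ofReal (φ n i (y i - v i)) := fun v =>
    Finset.measurable_fun_prod _ fun i _ => by fun_prop
  have hpm : Measurable p := hdens v
  have hqm : Measurable q := hdens w
  have hone : ∀ v : Fin n → ℝ, ∫⁻ y : Fin n → ℝ, ∏ i, ENNReal.ofReal (φ n i (y i - v i)) = 1 := by
    intro v
    have := hd.lintegral_shift hξ n v (F := fun _ => 1) measurable_const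
    simpa using this.symm
  have haff : ENNReal.ofReal (Real.exp (-(C / 2))) ≤ ∫⁻ y, (p y * q y) ^ (1 / 2 : ℝ) := by
    have h1 : ∀ y, (p y * q y) ^ (1 / 2 : ℝ) = ∏ i, (ENNReal.ofReal (φ n i (y i - v i)) *
        ENNReal.ofReal (φ n i (y i - w i))) ^ (1 / 2 : ℝ) := by
      intro y
      rw [hp, hq, ← Finset.prod_mul_distrib, ENNReal.prod_rpow_of_nonneg (by norm_num)]
    simp_rw [h1]
    rw [volume_pi, lintegral_fin_prod_eq_prod
      (f := fun i x => (ENNReal.ofReal (φ n i (x - v i)) *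
        ENNReal.ofReal (φ n i (x - w i))) ^ (1 / 2 : ℝ)) fun i => by fun_prop]
    calc ENNReal.ofReal (Real.exp (-(C / 2)))
        ≤ ENNReal.ofReal (∏ i, Real.exp (-((v i - w i) ^ 2 / σ₀ ^ 2 / 2))) := by
          rw [← Real.exp_sum, Finset.sum_neg_distrib, ← Finset.sum_div]
          gcongr
      _ = ∏ i, ENNReal.ofReal (Real.exp (-((v i - w i) ^ 2 / σ₀ ^ 2 / 2))) :=
          ENNReal.ofReal_prod_of_nonneg fun i _ => (Real.exp_pos _).le
      _ ≤ _ := by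
          refine Finset.prod_le_prod' fun i _ => ?_
          refine ((hKL i _ (hz i)).exp_le_affinity (hφ i) (hd.nonneg n i)
            (hd.lintegral_eq_one hξ n i)).trans (le_of_eq ?_)
          rw [← lintegral_sub_right_eq_self _ (v i)]
          refine lintegral_congr fun x => ?_
          rw [sub_add_sub_cancel]
  have h2 := affinity_sq_le hpm hqm (hone v) (hone w)
  have h3 : ENNReal.ofReal (Real.exp (-C) / 2) ≤ ∫⁻ y, min (p y) (q y) := by
    have h4 : ENNReal.ofReal (Real.exp (-C)) ≤ 2 * ∫⁻ y, min (p y) (q y) := by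
      refine le_trans ?_ h2
      have := ENNReal.rpow_le_rpow haff (by norm_num : (0 : ℝ) ≤ 2)
      rw [ENNReal.ofReal_rpow_of_nonneg (Real.exp_pos _).le (by norm_num), ← Real.exp_mul,
        neg_mul, div_mul_cancel₀ C two_ne_zero] at this
      exact this
    rw [ENNReal.ofReal_div_of_pos two_pos, ENNReal.ofReal_ofNat]
    exact ENNReal.div_le_of_le_mul' h4
  calc _ ≤ (∫⁻ y, min (p y) (q y)) * d := by gcongr
    _ = ∫⁻ y, min (p y) (q y) * d := (lintegral_mul_const _ (hpm.min hqm)).symm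
    _ ≤ ∫⁻ y, (p y * F y + q y * G y) := by
        refine lintegral_mono fun y => ?_
        calc min (p y) (q y) * d ≤ min (p y) (q y) * (F y + G y) := by gcongr; exact hFG y
          _ = min (p y) (q y) * F y + min (p y) (q y) * G y := mul_add _ _ _
          _ ≤ _ := by
            gcongr
            · exact min_le_left _ _
            · exact min_le_right _ _
    _ = _ := lintegral_add_left (hpm.mul hF) _

end Density

/-! ### The lower bound for `p ≤ 2` -/

theorem lpDist_eq {p : ℝ} (hp : 0 < p) (f g : ℝ → ℝ) :
    lpDist p f g = (∫⁻ x in Set.Ico (0 : ℝ) 1, ‖f x - g x‖ₑ ^ p) ^ (1 / p) := by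
  rw [lpDist, eLpNorm_eq_lintegral_rpow_enorm_toReal (by simpa using hp) ENNReal.ofReal_ne_top,
    ENNReal.toReal_ofReal hp.le]

theorem measurable_cells {n : ℕ} (v : ℕ → ℝ) : Measurable fun x : ℝ => v ⌊n * x⌋₊ :=
  (measurable_from_nat (f := v)).comp (Nat.measurable_floor.comp (measurable_const_mul _))

theorem cellMean_cells {n : ℕ} (v : ℕ → ℝ) (i : Fin n) :
    cellMean n (fun x => v ⌊n * x⌋₊) i = v i :=
  cellMean_eq_of_const fun x hx => by
    rw [floor_eq_of_mem_cell ((Nat.zero_le _).trans_lt i.2) hx]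

section Lower

variable {Ω : Type*} [MeasurableSpace Ω] {P : Measure Ω} {p r : ℝ} {n : ℕ} {e : Fin n → Ω → ℝ}

/-- Joint measurability in the randomness and the argument, as needed for exchanging the integrals. -/
theorem measurable_loss (he : ∀ i, Measurable (e i)) (g : Estimator n) {f : ℝ → ℝ}
    (hf : Measurable f) (t : ℝ) :
    Measurable fun z : Ω × ℝ => ‖g.1 (data n f fun i => e i z.1) z.2 - f z.2‖ₑ ^ t := by
  have h1 : Measurable fun z : Ω × ℝ => (data n f fun i => e i z.1, z.2) := by
    refine Measurable.prodMk (measurable_pi_lambda _ fun i => ?_) measurable_snd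
    exact ((he i).comp measurable_fst).const_add _
  have h2 := g.2.comp h1
  exact ((h2.sub (hf.comp measurable_snd)).enorm).pow_const t

theorem measurable_lpDist (hp : 0 < p) (he : ∀ i, Measurable (e i)) (g : Estimator n) {f : ℝ → ℝ}
    (hf : Measurable f) : Measurable fun ω => lpDist p (g.1 (data n f fun i => e i ω)) f := by
  simp_rw [lpDist_eq hp]
  exact ((measurable_loss he g hf p).lintegral_prod_right').pow_const _

/-- Lowering both exponents of the risk to a common `t` makes the loss an integral. -/
theorem le_risk [IsProbabilityMeasure P] (he : ∀ i, Measurable (e i)) (g : Estimator n) {f : ℝ → ℝ}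
    (hf : Measurable f) {t : ℝ} (ht : 0 < t) (htp : t ≤ p) (htr : t ≤ r) :
    (∫⁻ ω, (∫⁻ x in Set.Ico (0 : ℝ) 1, ‖g.1 (data n f fun i => e i ω) x - f x‖ₑ ^ t) ∂P) ^ (1 / t) ≤
      risk P p r n e (fun _ => g.1) f := by
  have := isProbabilityMeasure_restrict_Ico
  have hmono : ∀ ω, lpDist t (g.1 (data n f fun i => e i ω)) f ≤
      lpDist p (g.1 (data n f fun i => e i ω)) f := by
    intro ω
    refine eLpNorm_le_eLpNorm_of_exponent_le (ENNReal.ofReal_le_ofReal htp) ?_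
    exact ((g.2.comp measurable_prodMk_left).sub hf).aestronglyMeasurable
  have h1 := eLpNorm'_le_eLpNorm'_of_exponent_le ht htr P
    (measurable_lpDist ht he g hf).aestronglyMeasurable
  simp only [eLpNorm', enorm_eq_self] at h1
  have h2 : ∀ ω, lpDist t (g.1 (data n f fun i => e i ω)) f ^ t =
      ∫⁻ x in Set.Ico (0 : ℝ) 1, ‖g.1 (data n f fun i => e i ω) x - f x‖ₑ ^ t := by
    intro ω
    rw [lpDist_eq ht, ← ENNReal.rpow_mul, one_div_mul_cancel ht.ne', ENNReal.rpow_one]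
  simp_rw [h2] at h1
  refine h1.trans ?_
  have hr : 0 < r := ht.trans_le htr
  exact ENNReal.rpow_le_rpow (lintegral_mono fun ω => ENNReal.rpow_le_rpow (hmono ω) hr.le)
    (by positivity)

/-- The label of the block of `m` cells to which the cell `i` belongs. -/
def blockLabel (k m i : ℕ) : Fin (k + 1) := Fin.ofNat (k + 1) (i / m)

/-- The vertex of the hypercube of signals with the value `h` on the blocks selected by `θ`. -/
def vertex (k m : ℕ) (h : ℝ) (θ : Fin (k + 1) → Bool) (i : ℕ) : ℝ :=
  if θ (blockLabel k m i) then h else 0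

theorem vertex_mem_boundedSteps {k m : ℕ} (hn : 1 ≤ n) (hnm : n ≤ m * (k + 1))
    {h L : ℝ} (h0 : 0 ≤ h) (hL : h ≤ L) (θ : Fin (k + 1) → Bool) :
    (fun x : ℝ => vertex k m h θ ⌊n * x⌋₊) ∈ boundedSteps L k := by
  obtain ⟨j, hj, hstep⟩ := exists_isStep_of_cells hn (vertex k m h θ)
  refine ⟨⟨j, hj.trans ?_, hstep⟩, fun x _ => ?_⟩
  · have hsub : ∀ i ∈ (Finset.range (n - 1)).filter
        (fun i => vertex k m h θ i ≠ vertex k m h θ (i + 1)), (i + 1) / m = i / m + 1 := by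
      intro i hi
      rw [Finset.mem_filter] at hi
      by_contra hne
      refine hi.2 ?_
      have : (i + 1) / m = i / m := by
        rw [Nat.succ_div] at hne ⊢
        split_ifs at hne ⊢ with hdvd
        · exact absurd rfl hne
        · rfl
      have hlabel : blockLabel k m (i + 1) = blockLabel k m i := by
        rw [blockLabel, blockLabel, this]
      rw [vertex, vertex, hlabel]
    calc _ ≤ (Finset.range k).card := by
          refine Finset.card_le_card_of_injOn (fun i => i / m) ?_ ?_
          · intro i hi
            have h1 := hsub i hi
            rw [Finset.mem_coe, Finset.mem_filter, Finset.mem_range] at hi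
            have h2 : (i + 1) / m < k + 1 := Nat.div_lt_of_lt_mul (by omega)
            simp only [Finset.coe_range, Set.mem_Iio]
            omega
          · intro i hi i' hi' hii
            have h1 := hsub i hi
            have h2 := hsub i' hi'
            simp only at hii
            rcases lt_trichotomy i i' with hlt | heq | hlt
            · have : (i + 1) / m ≤ i' / m := Nat.div_le_div_right hlt
              omega
            · exact heq
            · have : (i' + 1) / m ≤ i / m := Nat.div_le_div_right hlt
              omega
      _ = k := Finset.card_range k
  · simp only [vertex]
    split_ifs
    · rwa [abs_of_nonneg h0]
    · rw [abs_zero]; linarith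

theorem card_blockLabel_le {k m : ℕ} (hm : 1 ≤ m) (hnm : n ≤ m * (k + 1)) (b : Fin (k + 1)) :
    (Finset.univ.filter fun i : Fin n => blockLabel k m i = b).card ≤ m := by
  calc _ ≤ (Finset.Ico (m * b.val) (m * b.val + m)).card := by
        refine Finset.card_le_card_of_injOn Fin.val ?_ Fin.val_injective.injOn
        intro i hi
        rw [Finset.mem_coe, Finset.mem_filter] at hi
        have h1 : i.val / m < k + 1 := Nat.div_lt_of_lt_mul (by omega)
        have h2 : i.val / m = b.val := by
          rw [← hi.2, blockLabel, Fin.val_ofNat, Nat.mod_eq_of_lt h1]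
        rw [Finset.mem_coe, Finset.mem_Ico, ← h2]
        have h3 := Nat.div_add_mod i.val m
        have h4 := Nat.mod_lt i.val hm
        omega
    _ = m := by simp

/-- Switching the block `b` on or off. -/
def toggle {k : ℕ} (b : Fin (k + 1)) (θ : Fin (k + 1) → Bool) : Fin (k + 1) → Bool :=
  Function.update θ b (!θ b)

theorem toggle_involutive {k : ℕ} (b : Fin (k + 1)) : Function.Involutive (toggle b) := by
  intro θ
  simp [toggle]

theorem vertex_sub_toggle {k m : ℕ} {h : ℝ} (θ : Fin (k + 1) → Bool) (b : Fin (k + 1)) (i : ℕ) :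
    |vertex k m h θ i - vertex k m h (toggle b θ) i| =
      if blockLabel k m i = b then |h| else 0 := by
  by_cases hb : blockLabel k m i = b
  · have htoggle : toggle b θ b = !θ b := Function.update_self _ _ _
    simp only [vertex, hb, htoggle]
    cases θ b <;> simp
  · have htoggle : toggle b θ (blockLabel k m i) = θ (blockLabel k m i) := Function.update_of_ne hb _ _
    simp only [vertex, htoggle, if_neg hb, sub_self, abs_zero]

/-- The hypercube bound: with blocks of `m` cells and the height `1 / √m` no estimator can detect
the state of a block, so at every `x` the mean loss over the hypercube is of the order of the
height; the loss `|·|^t`, `t ≤ 1`, satisfies the triangle inequality. -/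
theorem hypercube_le_iSup_risk [IsProbabilityMeasure P] {σ σ₀ z₀ L t : ℝ}
    {ξ : (n : ℕ) → Fin n → Ω → ℝ} {φ : (n : ℕ) → Fin n → ℝ → ℝ} (hξ : IsNoise P σ ξ)
    (hd : HasNoiseDensity P ξ φ)
    (hKL : ∀ n i z, |z| ≤ z₀ → ShiftKLLe (φ n i) z (z ^ 2 / σ₀ ^ 2))
    (ht : 0 < t) (ht1 : t ≤ 1) (htp : t ≤ p) (htr : t ≤ r)
    {k m : ℕ} (hn : 1 ≤ n) (hm : 1 ≤ m) (hnm : n ≤ m * (k + 1))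
    (hmL : 1 / √(m : ℝ) ≤ L) (hmz : 1 / √(m : ℝ) ≤ z₀) (g : Estimator n) :
    ENNReal.ofReal ((Real.exp (-(1 / σ₀ ^ 2)) / 4) ^ (1 / t) * (1 / √(m : ℝ))) ≤
      ⨆ f ∈ boundedSteps L k, risk P p r n (ξ n) (fun _ => g.1) f := by
  classical
  have hm0 : (0 : ℝ) < m := by exact_mod_cast hm
  set h := 1 / √(m : ℝ) with hh
  have h0 : 0 < h := by positivity
  have hsq : h ^ 2 = 1 / m := by rw [hh, div_pow, one_pow, Real.sq_sqrt hm0.le]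
  set s := ⨆ f ∈ boundedSteps L k, risk P p r n (ξ n) (fun _ => g.1) f with hs
  let f : (Fin (k + 1) → Bool) → ℝ → ℝ := fun θ x => vertex k m h θ ⌊n * x⌋₊
  have hfm : ∀ θ, Measurable (f θ) := fun θ => measurable_cells _
  have hdata : ∀ θ ω, data n (f θ) (fun i => ξ n i ω) =
      fun i : Fin n => vertex k m h θ i + ξ n i ω := by
    intro θ ω
    funext i
    rw [data, cellMean_cells]
  let loss : (Fin (k + 1) → Bool) → ℝ → ℝ≥0∞ := fun θ x =>
    ∫⁻ ω, ‖g.1 (data n (f θ) fun i => ξ n i ω) x - f θ x‖ₑ ^ t ∂P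
  have hlm : ∀ θ, Measurable (loss θ) := fun θ =>
    (measurable_loss (hξ.meas n) g (hfm θ) t).lintegral_prod_left'
  have hle : ∀ θ, ∫⁻ x in Set.Ico (0 : ℝ) 1, loss θ x ≤ s ^ t := by
    intro θ
    have h1 : risk P p r n (ξ n) (fun _ => g.1) (f θ) ≤ s :=
      le_iSup₂_of_le _ (vertex_mem_boundedSteps hn hnm h0.le hmL θ) le_rfl
    have h2 := ENNReal.rpow_le_rpow ((le_risk (hξ.meas n) g (hfm θ) ht htp htr).trans h1) ht.le
    rw [← ENNReal.rpow_mul, one_div_mul_cancel ht.ne', ENNReal.rpow_one] at h2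
    refine le_trans (le_of_eq ?_) h2
    exact (lintegral_lintegral_swap (measurable_loss (hξ.meas n) g (hfm θ) t).aemeasurable).symm
  set d := ENNReal.ofReal (Real.exp (-(1 / σ₀ ^ 2)) / 2) * ENNReal.ofReal (h ^ t) with hddef
  have hpair : ∀ θ x, d ≤ loss θ x + loss (toggle (blockLabel k m ⌊n * x⌋₊) θ) x := by
    intro θ x
    set b := blockLabel k m ⌊n * x⌋₊ with hb
    have hgx : Measurable fun y : Fin n → ℝ => g.1 y x := g.2.comp measurable_prodMk_right
    have hdiff := fun i => vertex_sub_toggle (h := h) (m := m) θ b i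
    rw [abs_of_pos h0] at hdiff
    have key := hd.le_add_risk hξ (n := n) (σ₀ := σ₀) (z₀ := z₀) (C := 1 / σ₀ ^ 2) (hKL n)
      (v := fun i => vertex k m h θ i) (w := fun i => vertex k m h (toggle b θ) i)
      (F := fun y => ‖g.1 y x - f θ x‖ₑ ^ t) (G := fun y => ‖g.1 y x - f (toggle b θ) x‖ₑ ^ t)
      (d := ENNReal.ofReal (h ^ t)) ?_ ?_ ((hgx.sub_const _).enorm.pow_const t)
      ((hgx.sub_const _).enorm.pow_const t) ?_
    · simp only [loss, hdata]
      exact key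
    · intro i
      rw [hdiff]
      split_ifs
      · exact hmz
      · exact h0.le.trans hmz
    · calc ∑ i : Fin n, (vertex k m h θ i - vertex k m h (toggle b θ) i) ^ 2 / σ₀ ^ 2
          = ∑ i : Fin n, if blockLabel k m i = b then 1 / m / σ₀ ^ 2 else 0 := by
            refine Finset.sum_congr rfl fun i _ => ?_
            rw [← sq_abs, hdiff]
            split_ifs
            · rw [hsq]
            · simp
        _ = (Finset.univ.filter fun i : Fin n => blockLabel k m i = b).card *
              (1 / m / σ₀ ^ 2) := by
            rw [← Finset.sum_filter, Finset.sum_const, nsmul_eq_mul]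
        _ ≤ m * (1 / m / σ₀ ^ 2) := by
            gcongr
            exact card_blockLabel_le hm hnm b
        _ = 1 / σ₀ ^ 2 := by field_simp
    · intro y
      have e1 : h = ‖f θ x - f (toggle b θ) x‖ := by
        rw [Real.norm_eq_abs, hdiff ⌊n * x⌋₊, if_pos hb.symm]
      have e2 : ENNReal.ofReal (h ^ t) = ‖f θ x - f (toggle b θ) x‖ₑ ^ t := by
        rw [← ENNReal.ofReal_rpow_of_nonneg h0.le ht.le, e1, ofReal_norm]
      rw [e2]
      calc ‖f θ x - f (toggle b θ) x‖ₑ ^ t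
          ≤ (‖g.1 y x - f θ x‖ₑ + ‖g.1 y x - f (toggle b θ) x‖ₑ) ^ t := by
            refine ENNReal.rpow_le_rpow ?_ ht.le
            have : f θ x - f (toggle b θ) x =
                (g.1 y x - f (toggle b θ) x) - (g.1 y x - f θ x) := by ring
            rw [this, add_comm]
            exact enorm_sub_le
        _ ≤ _ := ENNReal.rpow_add_le_add_rpow _ _ ht.le ht1
  set N : ℝ≥0∞ := (Fintype.card (Fin (k + 1) → Bool) : ℝ≥0∞) with hN
  have hN0 : N ≠ 0 := by simp [hN]
  have hNtop : N ≠ ∞ := ENNReal.natCast_ne_top _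
  have hx : ∀ x, N * d ≤ 2 * ∑ θ, loss θ x := by
    intro x
    set b := blockLabel k m ⌊n * x⌋₊
    have h1 : ∑ θ, loss (toggle b θ) x = ∑ θ, loss θ x :=
      Equiv.sum_comp (Function.Involutive.toPerm _ (toggle_involutive b)) fun θ => loss θ x
    calc N * d = ∑ _θ : Fin (k + 1) → Bool, d := by
          rw [Finset.sum_const, Finset.card_univ, nsmul_eq_mul]
      _ ≤ ∑ θ, (loss θ x + loss (toggle b θ) x) := Finset.sum_le_sum fun θ _ => hpair θ x
      _ = _ := by rw [Finset.sum_add_distrib, h1, two_mul]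
  have htot : N * d ≤ N * (2 * s ^ t) := by
    calc N * d = ∫⁻ _x in Set.Ico (0 : ℝ) 1, N * d := by simp
      _ ≤ ∫⁻ x in Set.Ico (0 : ℝ) 1, 2 * ∑ θ, loss θ x := lintegral_mono hx
      _ = 2 * ∑ θ, ∫⁻ x in Set.Ico (0 : ℝ) 1, loss θ x := by
          rw [lintegral_const_mul _ (Finset.measurable_fun_sum _ fun θ _ => hlm θ),
            lintegral_finsetSum _ fun θ _ => hlm θ]
      _ ≤ 2 * ∑ _θ : Fin (k + 1) → Bool, s ^ t := by
          gcongr with θ _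
          exact hle θ
      _ = N * (2 * s ^ t) := by
          rw [Finset.sum_const, Finset.card_univ, nsmul_eq_mul]; ring
  have hfin : d ≤ 2 * s ^ t := (ENNReal.mul_le_mul_iff_right hN0 hNtop).1 htot
  rw [← ENNReal.rpow_le_rpow_iff ht, ENNReal.ofReal_rpow_of_nonneg (by positivity) ht.le,
    Real.mul_rpow (by positivity) h0.le, ← Real.rpow_mul (by positivity),
    one_div_mul_cancel ht.ne', Real.rpow_one]
  rw [← ENNReal.mul_le_mul_iff_right (a := 2) two_ne_zero ENNReal.ofNat_ne_top]
  refine le_trans (le_of_eq ?_) hfin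
  rw [hddef, ← ENNReal.ofReal_mul (by positivity), ← ENNReal.ofReal_ofNat,
    ← ENNReal.ofReal_mul (by norm_num)]
  congr 1; ring

/-- A lower bound of the order `(V n)⁻¹` makes the normalized lower limit positive. -/
theorem zero_lt_liminf_of_le {V : ℕ → ℝ} (hV : ∀ᶠ n in atTop, 0 < V n) {I : ℕ → ℝ≥0∞} {κ : ℝ}
    (hκ : 0 < κ) (h : ∀ᶠ n in atTop, ENNReal.ofReal (κ * (V n)⁻¹) ≤ I n) :
    0 < liminf (fun n => ENNReal.ofReal (V n) * I n) atTop := by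
  refine (ENNReal.ofReal_pos.2 hκ).trans_le (le_liminf_of_le (by isBoundedDefault) ?_)
  filter_upwards [hV, h] with n hVn hn
  calc ENNReal.ofReal κ = ENNReal.ofReal (V n) * ENNReal.ofReal (κ * (V n)⁻¹) := by
        rw [← ENNReal.ofReal_mul hVn.le]; congr 1; field_simp
    _ ≤ _ := by gcongr

theorem liminf_pos_of_le_two [IsProbabilityMeasure P] {σ σ₀ z₀ L : ℝ}
    {ξ : (n : ℕ) → Fin n → Ω → ℝ} {φ : (n : ℕ) → Fin n → ℝ → ℝ} (hξ : IsNoise P σ ξ)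
    (hp : 0 < p) (hr : 0 < r) (hL : 0 < L) {k : ℕ → ℕ}
    (hk : (fun n => (k n : ℝ)) =o[atTop] (fun n => (n : ℝ))) (hz₀ : 0 < z₀)
    (hd : HasNoiseDensity P ξ φ)
    (hKL : ∀ n i z, |z| ≤ z₀ → ShiftKLLe (φ n i) z (z ^ 2 / σ₀ ^ 2)) (hp2 : p ≤ 2) :
    0 < liminf (fun n : ℕ => ENNReal.ofReal (invRate p n (k n)) *
      ⨅ g : Estimator n, ⨆ f ∈ boundedSteps L (k n),
        risk P p r n (ξ n) (fun _ => g.1) f) atTop := by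
  set t := min 1 (min p r) with ht
  have ht0 : 0 < t := lt_min one_pos (lt_min hp hr)
  obtain ⟨M, hM⟩ := exists_nat_ge (max 1 (max ((1 / L) ^ 2) ((1 / z₀) ^ 2)))
  have hM1 : (1 : ℝ) ≤ M := (le_max_left _ _).trans hM
  have hML : (1 / L) ^ 2 ≤ M := ((le_max_left _ _).trans (le_max_right _ _)).trans hM
  have hMz : (1 / z₀) ^ 2 ≤ M := ((le_max_right _ _).trans (le_max_right _ _)).trans hM
  refine zero_lt_liminf_of_le (κ := (Real.exp (-(1 / σ₀ ^ 2)) / 4) ^ (1 / t) * (1 / 2)) ?_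
    (by positivity) ?_
  · filter_upwards [eventually_ge_atTop 1] with n hn using invRate_pos hn
  have hsmall := hk.def (c := 1 / (2 * M)) (by positivity)
  filter_upwards [hsmall, eventually_ge_atTop (2 * M)] with n hkn hn
  rw [Real.norm_natCast, Real.norm_natCast] at hkn
  have hM1' : 1 ≤ M := by exact_mod_cast hM1
  have hn1 : 1 ≤ n := by omega
  have hn0 : (0 : ℝ) < n := by exact_mod_cast hn1
  have hnM : (2 : ℝ) * M ≤ n := by exact_mod_cast hn
  have hMk : (M : ℝ) * (k n + 1) ≤ n := by
    have : (k n : ℝ) * (2 * M) ≤ n := by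
      rw [one_div_mul_eq_div, le_div_iff₀ (by positivity)] at hkn; exact hkn
    linarith
  have hMk' : M * (k n + 1) ≤ n := by exact_mod_cast hMk
  -- `m` is `n / (k n + 1)` rounded up, so that `k n + 1` blocks of `m` cells cover all cells.
  set m := (n + k n) / (k n + 1) with hmdef
  have hMm : M ≤ m := by
    rw [hmdef, Nat.le_div_iff_mul_le (Nat.succ_pos _)]
    exact hMk'.trans (Nat.le_add_right _ _)
  have hm1 : 1 ≤ m := by omega
  have hmr : (M : ℝ) ≤ m := by exact_mod_cast hMm
  have hm0 : (0 : ℝ) < m := by linarith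
  have hnm : n ≤ m * (k n + 1) := by
    have := Nat.lt_mul_div_succ (n + k n) (Nat.succ_pos (k n))
    rw [← Nat.succ_eq_add_one] at hmdef
    rw [← hmdef] at this
    have h2 : (k n).succ * (m + 1) = m * (k n + 1) + (k n + 1) := by
      rw [Nat.succ_eq_add_one]; ring
    omega
  have hmn : m * (k n + 1) ≤ n + k n := Nat.div_mul_le_self _ _
  have hroot : ∀ c : ℝ, 0 < c → (1 / c) ^ 2 ≤ M → 1 / √(m : ℝ) ≤ c := by
    intro c hc hcM
    rw [one_div_le (by positivity) hc]
    exact Real.le_sqrt_of_sq_le (hcM.trans hmr)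
  refine le_iInf fun g => ?_
  refine le_trans (ENNReal.ofReal_le_ofReal ?_)
    (hypercube_le_iSup_risk hξ hd hKL ht0 (min_le_left _ _)
      ((min_le_right _ _).trans (min_le_left _ _)) ((min_le_right _ _).trans (min_le_right _ _))
      hn1 hm1 hnm (hroot L hL hML) (hroot z₀ hz₀ hMz) g)
  rw [mul_assoc]
  gcongr
  rw [← inv_invRate hp, max_eq_right hp2, ← Real.sqrt_eq_rpow, ← Real.sqrt_one, ← Real.sqrt_div
    zero_le_one, Real.sqrt_one]
  refine Real.le_sqrt_of_sq_le ?_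
  rw [mul_pow, Real.sq_sqrt (by positivity), le_div_iff₀ hm0]
  have hk1 : (k n : ℝ) ≤ n := by nlinarith [(Nat.cast_nonneg (k n) : (0 : ℝ) ≤ k n)]
  have hmn' : (m : ℝ) * (k n + 1) ≤ n + k n := by exact_mod_cast hmn
  have e : (1 / 2 : ℝ) ^ 2 * ((2 * k n + 1) / n) * m = (2 * k n + 1) * m / (4 * n) := by
    field_simp; norm_num
  rw [e, div_le_one (by positivity)]
  nlinarith

/-! ### The lower bound for `p > 2` -/

/-- A signal that alternates between `0` and `L`, with the `k` jumps in the middles of the first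
`k` cells. -/
noncomputable def comb (L : ℝ) (n k : ℕ) (x : ℝ) : ℝ :=
  L * ((min ⌊n * x + 1 / 2⌋₊ k % 2 : ℕ) : ℝ)

/-- The cell means of `comb`. -/
noncomputable def combMean (L : ℝ) (k i : ℕ) : ℝ :=
  if i < k then L / 2 else L * ((k % 2 : ℕ) : ℝ)

theorem measurable_comb (L : ℝ) (n k : ℕ) : Measurable (comb L n k) := by
  have h : Measurable fun x : ℝ => ⌊n * x + 1 / 2⌋₊ := Nat.measurable_floor.comp (by fun_prop)
  exact (measurable_from_nat (f := fun j => L * ((min j k % 2 : ℕ) : ℝ))).comp h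

theorem abs_comb_le {L : ℝ} (hL : 0 ≤ L) (n k : ℕ) (x : ℝ) : |comb L n k x| ≤ L := by
  rw [comb]
  rcases Nat.mod_two_eq_zero_or_one (min ⌊n * x + 1 / 2⌋₊ k) with h | h <;> rw [h]
  · simpa using hL
  · simp [abs_of_nonneg hL]

theorem comb_mem_boundedSteps {L : ℝ} (hL : 0 < L) {k : ℕ} (hn : 1 ≤ n) (hkn : k ≤ n) :
    comb L n k ∈ boundedSteps L k := by
  have hn0 : (0 : ℝ) < n := by exact_mod_cast hn
  refine ⟨⟨k, le_rfl, fun i => if i = 0 then 0 else if i ≤ k then (i - 1 / 2 : ℝ) / n else 1,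
    fun i => L * ((i % 2 : ℕ) : ℝ), by simp, by simp, ?_, ?_, ?_⟩, fun x _ => abs_comb_le hL.le n k x⟩
  · intro i hi
    simp only [Nat.add_eq_zero_iff, one_ne_zero, and_false, if_false]
    rcases Nat.eq_zero_or_pos i with rfl | hi0
    · rw [if_pos rfl]
      split_ifs
      · push_cast; exact div_pos (by norm_num) hn0
      · exact one_pos
    · rw [if_neg hi0.ne', if_pos hi]
      split_ifs
      · push_cast; gcongr; linarith
      · rw [div_lt_one hn0]
        have : (i : ℝ) ≤ n := by exact_mod_cast hi.trans hkn
        linarith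
  · intro i _ heq
    have h1 := mul_left_cancel₀ hL.ne' heq
    have h2 : i % 2 = (i + 1) % 2 := by exact_mod_cast h1
    omega
  · intro i hi x hx
    have hx1 := hx.1
    have hx2 := hx.2
    simp only [Nat.add_eq_zero_iff, one_ne_zero, and_false, if_false] at hx2
    have hlow : i ≤ ⌊n * x + 1 / 2⌋₊ := by
      rcases Nat.eq_zero_or_pos i with rfl | hi0
      · exact Nat.zero_le _
      · simp only [hi0.ne', if_false, hi, if_true] at hx1
        rw [div_le_iff₀ hn0] at hx1
        exact Nat.le_floor (by linarith)
    have hmin : min ⌊n * x + 1 / 2⌋₊ k = i := by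
      rcases hi.lt_or_eq with hlt | rfl
      · rw [if_pos (Nat.succ_le_of_lt hlt), lt_div_iff₀ hn0] at hx2
        push_cast at hx2
        have : ⌊n * x + 1 / 2⌋₊ < i + 1 := by
          rw [Nat.floor_lt' (Nat.succ_ne_zero i)]; push_cast; linarith
        omega
      · exact min_eq_right hlow
    rw [comb, hmin]

theorem comb_left {L : ℝ} {k i : ℕ} (hn : 1 ≤ n) (hik : i < k) {x : ℝ}
    (hx : x ∈ Set.Ico ((i : ℝ) / n) ((i + 1 / 2 : ℝ) / n)) :
    comb L n k x = L * ((i % 2 : ℕ) : ℝ) := by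
  have hn0 : (0 : ℝ) < n := by exact_mod_cast hn
  have hx1 := hx.1
  have hx2 := hx.2
  rw [div_le_iff₀ hn0] at hx1
  rw [lt_div_iff₀ hn0] at hx2
  have : ⌊n * x + 1 / 2⌋₊ = i := by
    rw [Nat.floor_eq_iff (by nlinarith [(Nat.cast_nonneg i : (0 : ℝ) ≤ i)])]
    constructor <;> linarith
  rw [comb, this, min_eq_left hik.le]

theorem comb_right {L : ℝ} {k i : ℕ} (hn : 1 ≤ n) (hik : i < k) {x : ℝ}
    (hx : x ∈ Set.Ico ((i + 1 / 2 : ℝ) / n) ((i + 1 : ℝ) / n)) :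
    comb L n k x = L * (((i + 1) % 2 : ℕ) : ℝ) := by
  have hn0 : (0 : ℝ) < n := by exact_mod_cast hn
  have hx1 := hx.1
  have hx2 := hx.2
  rw [div_le_iff₀ hn0] at hx1
  rw [lt_div_iff₀ hn0] at hx2
  have : ⌊n * x + 1 / 2⌋₊ = i + 1 := by
    rw [Nat.floor_eq_iff (by nlinarith [(Nat.cast_nonneg i : (0 : ℝ) ≤ i)])]
    push_cast
    constructor <;> linarith
  rw [comb, this, min_eq_left hik]

theorem cellMean_comb {L : ℝ} {k : ℕ} (i : Fin n) :
    cellMean n (comb L n k) i = combMean L k i := by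
  have hn : 1 ≤ n := (Nat.zero_le _).trans_lt i.2
  have hn0 : (0 : ℝ) < n := by exact_mod_cast hn
  rw [combMean]
  split_ifs with hik
  · have h1 : (i : ℝ) / n ≤ (i + 1 / 2 : ℝ) / n := by gcongr; linarith
    have h2 : (i + 1 / 2 : ℝ) / n ≤ (i + 1 : ℝ) / n := by gcongr; linarith
    have hint : ∀ a b : ℝ, IntegrableOn (comb L n k) (Set.Ico a b) := by
      intro a b
      refine Measure.integrableOn_of_bounded (M := |L|) (by simp)
        (measurable_comb L n k).aestronglyMeasurable (ae_of_all _ fun x => ?_)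
      rw [comb, Real.norm_eq_abs, abs_mul]
      rcases Nat.mod_two_eq_zero_or_one (min ⌊n * x + 1 / 2⌋₊ k) with h | h <;> rw [h] <;> simp
    rw [cellMean, ← Set.Ico_union_Ico_eq_Ico h1 h2, setIntegral_union
      (Set.Ico_disjoint_Ico_same) measurableSet_Ico (hint _ _) (hint _ _),
      setIntegral_congr_fun measurableSet_Ico fun x hx => comb_left hn hik hx,
      setIntegral_congr_fun measurableSet_Ico fun x hx => comb_right hn hik hx]
    simp only [integral_const, measureReal_restrict_apply_univ, Real.volume_real_Ico, smul_eq_mul]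
    rw [max_eq_left (by linarith), max_eq_left (by linarith)]
    have h3 : ((i.val % 2 : ℕ) : ℝ) + (((i.val + 1) % 2 : ℕ) : ℝ) = 1 := by
      exact_mod_cast (by omega : i.val % 2 + (i.val + 1) % 2 = 1)
    field_simp
    linear_combination L * h3
  · refine cellMean_eq_of_const fun x hx => ?_
    have hx1 := hx.1
    rw [div_le_iff₀ hn0] at hx1
    have : k ≤ ⌊n * x + 1 / 2⌋₊ := by
      refine Nat.le_floor ?_
      have : (k : ℝ) ≤ i := by exact_mod_cast not_lt.1 hik
      linarith
    rw [comb, min_eq_right this]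

theorem combMean_mem_boundedSteps {L : ℝ} (hL : 0 < L) {k : ℕ} (hn : 1 ≤ n) (hk : 1 ≤ k) :
    (fun x : ℝ => combMean L k ⌊n * x⌋₊) ∈ boundedSteps L k := by
  obtain ⟨j, hj, hstep⟩ := exists_isStep_of_cells hn (combMean L k)
  refine ⟨⟨j, hj.trans (le_trans ?_ hk), hstep⟩, fun x _ => ?_⟩
  · refine (Finset.card_le_card (t := {k - 1}) fun i hi => ?_).trans
      (Finset.card_singleton _).le
    rw [Finset.mem_filter] at hi
    rw [Finset.mem_singleton]
    by_contra hne
    refine hi.2 ?_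
    rw [combMean, combMean]
    rcases Nat.lt_or_ge i k with h | h
    · rw [if_pos h, if_pos (by omega)]
    · rw [if_neg (by omega), if_neg (by omega)]
  · simp only [combMean]
    split_ifs
    · rw [abs_of_pos (by linarith)]; linarith
    · rcases Nat.mod_two_eq_zero_or_one k with h | h <;> rw [h]
      · simpa using hL.le
      · simp [abs_of_pos hL]

theorem le_lpDist_comb {L : ℝ} (hL : 0 < L) (hp : 0 < p) {k : ℕ} (hn : 1 ≤ n) (hkn : k ≤ n) :
    ENNReal.ofReal (L / 2 * ((k : ℝ) / n) ^ (1 / p)) ≤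
      lpDist p (comb L n k) fun x => combMean L k ⌊n * x⌋₊ := by
  have hn0 : (0 : ℝ) < n := by exact_mod_cast hn
  have hk1 : (k : ℝ) / n ≤ 1 := by rw [div_le_one hn0]; exact_mod_cast hkn
  rw [lpDist_eq hp]
  have hsub : Set.Ico (0 : ℝ) ((k : ℝ) / n) ⊆ Set.Ico 0 1 := Set.Ico_subset_Ico_right hk1
  have hval : ∀ x ∈ Set.Ico (0 : ℝ) ((k : ℝ) / n),
      ‖comb L n k x - combMean L k ⌊n * x⌋₊‖ₑ ^ p = ENNReal.ofReal ((L / 2) ^ p) := by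
    intro x hx
    have hx2 := hx.2
    rw [lt_div_iff₀ hn0] at hx2
    have hfl : ⌊n * x⌋₊ < k := by
      rw [Nat.floor_lt (mul_nonneg hn0.le hx.1)]; linarith
    have habs : |comb L n k x - combMean L k ⌊n * x⌋₊| = L / 2 := by
      rw [combMean, if_pos hfl, comb]
      rcases Nat.mod_two_eq_zero_or_one (min ⌊n * x + 1 / 2⌋₊ k) with h | h <;> rw [h]
      · rw [Nat.cast_zero, mul_zero, zero_sub, abs_neg, abs_of_pos (by linarith)]
      · rw [Nat.cast_one, mul_one, sub_half, abs_of_pos (by linarith)]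
    rw [Real.enorm_eq_ofReal_abs, habs, ENNReal.ofReal_rpow_of_nonneg (by linarith) hp.le]
  calc ENNReal.ofReal (L / 2 * ((k : ℝ) / n) ^ (1 / p))
      = (∫⁻ x in Set.Ico (0 : ℝ) ((k : ℝ) / n),
          ‖comb L n k x - combMean L k ⌊n * x⌋₊‖ₑ ^ p) ^ (1 / p) := by
        rw [setLIntegral_congr_fun measurableSet_Ico hval, setLIntegral_const, Real.volume_Ico,
          sub_zero, ← ENNReal.ofReal_mul (by positivity),
          ENNReal.ofReal_rpow_of_nonneg (by positivity) (by positivity),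
          Real.mul_rpow (by positivity) (by positivity), ← Real.rpow_mul (by positivity),
          mul_one_div_cancel hp.ne', Real.rpow_one]
    _ ≤ _ := ENNReal.rpow_le_rpow (lintegral_mono_set hsub) (by positivity)

/-- Two signals with the same cell means produce the same data, so that every estimator errs by
half their distance at one of them. -/
theorem lpDist_le_iSup_risk [IsProbabilityMeasure P] (hp : 1 ≤ p) (hr : 0 < r)
    (he : ∀ i, Measurable (e i)) (g : Estimator n) {A : Set (ℝ → ℝ)} {f₁ f₂ : ℝ → ℝ}
    (hf₁ : Measurable f₁) (hf₂ : Measurable f₂) (h₁ : f₁ ∈ A) (h₂ : f₂ ∈ A)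
    (hmean : cellMean n f₁ = cellMean n f₂) {d : ℝ} (hd : 0 ≤ d)
    (hdist : ENNReal.ofReal d ≤ lpDist p f₁ f₂) :
    ENNReal.ofReal (d / 2 * (1 / 2) ^ (1 / r)) ≤ ⨆ f ∈ A, risk P p r n e (fun _ => g.1) f := by
  have hp0 : 0 < p := by linarith
  set s := ⨆ f ∈ A, risk P p r n e (fun _ => g.1) f with hs
  have hdata : ∀ ω, data n f₁ (fun i => e i ω) = data n f₂ fun i => e i ω := by
    intro ω; funext i; rw [data, data, hmean]
  let X : (ℝ → ℝ) → Ω → ℝ≥0∞ := fun f ω => lpDist p (g.1 (data n f fun i => e i ω)) f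
  have hle : ∀ f ∈ A, ∫⁻ ω, X f ω ^ r ∂P ≤ s ^ r := by
    intro f hf
    have h1 : risk P p r n e (fun _ => g.1) f ≤ s := le_iSup₂_of_le f hf le_rfl
    have h2 := ENNReal.rpow_le_rpow h1 hr.le
    rwa [risk, ← ENNReal.rpow_mul, one_div_mul_cancel hr.ne', ENNReal.rpow_one] at h2
  have hpt : ∀ ω, ENNReal.ofReal ((d / 2) ^ r) ≤ X f₁ ω ^ r + X f₂ ω ^ r := by
    intro ω
    have hg : Measurable (g.1 (data n f₂ fun i => e i ω)) := g.2.comp measurable_prodMk_left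
    have htri : ENNReal.ofReal d ≤ X f₁ ω + X f₂ ω := by
      refine hdist.trans ?_
      simp only [X, hdata]
      set u := g.1 (data n f₂ fun i => e i ω)
      have h1 : (fun x => f₁ x - f₂ x) = (fun x => u x - f₂ x) - fun x => u x - f₁ x := by
        funext x; simp
      rw [lpDist, h1, add_comm]
      exact eLpNorm_sub_le (hg.sub hf₂).aestronglyMeasurable (hg.sub hf₁).aestronglyMeasurable
        (by rw [ENNReal.one_le_ofReal]; exact hp)
    have hcases : ENNReal.ofReal (d / 2) ≤ X f₁ ω ∨ ENNReal.ofReal (d / 2) ≤ X f₂ ω := by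
      by_contra hcon
      push Not at hcon
      have h1 := ENNReal.add_lt_add hcon.1 hcon.2
      rw [← ENNReal.ofReal_add (by positivity) (by positivity), add_halves] at h1
      exact absurd htri (not_le.2 h1)
    rw [← ENNReal.ofReal_rpow_of_nonneg (by positivity) hr.le]
    rcases hcases with h | h
    · exact le_add_right (ENNReal.rpow_le_rpow h hr.le)
    · exact le_add_left (ENNReal.rpow_le_rpow h hr.le)
  have htot : ENNReal.ofReal ((d / 2) ^ r) ≤ 2 * s ^ r := by
    calc ENNReal.ofReal ((d / 2) ^ r) = ∫⁻ _ω, ENNReal.ofReal ((d / 2) ^ r) ∂P := by simp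
      _ ≤ ∫⁻ ω, (X f₁ ω ^ r + X f₂ ω ^ r) ∂P := lintegral_mono hpt
      _ = ∫⁻ ω, X f₁ ω ^ r ∂P + ∫⁻ ω, X f₂ ω ^ r ∂P :=
          lintegral_add_left ((measurable_lpDist hp0 he g hf₁).pow_const r) _
      _ ≤ s ^ r + s ^ r := add_le_add (hle _ h₁) (hle _ h₂)
      _ = 2 * s ^ r := (two_mul _).symm
  rw [← ENNReal.rpow_le_rpow_iff hr, ENNReal.ofReal_rpow_of_nonneg (by positivity) hr.le,
    Real.mul_rpow (by positivity) (by positivity), ← Real.rpow_mul (by positivity),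
    one_div_mul_cancel hr.ne', Real.rpow_one,
    ← ENNReal.mul_le_mul_iff_right (a := 2) two_ne_zero ENNReal.ofNat_ne_top]
  refine le_trans (le_of_eq ?_) htot
  rw [← ENNReal.ofReal_ofNat, ← ENNReal.ofReal_mul (by norm_num)]
  congr 1; ring

theorem liminf_pos_of_two_lt [IsProbabilityMeasure P] {L : ℝ}
    {ξ : (n : ℕ) → Fin n → Ω → ℝ} (hξ : ∀ n i, Measurable (ξ n i))
    (hp : 2 < p) (hr : 0 < r) (hL : 0 < L) {k : ℕ → ℕ}
    (hk : (fun n => (k n : ℝ)) =o[atTop] (fun n => (n : ℝ))) (hk1 : ∀ᶠ n in atTop, 1 ≤ k n) :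
    0 < liminf (fun n : ℕ => ENNReal.ofReal (invRate p n (k n)) *
      ⨅ g : Estimator n, ⨆ f ∈ boundedSteps L (k n),
        risk P p r n (ξ n) (fun _ => g.1) f) atTop := by
  have hp0 : 0 < p := by linarith
  refine zero_lt_liminf_of_le (κ := L / 12 * (1 / 2) ^ (1 / r)) ?_ (by positivity) ?_
  · filter_upwards [eventually_ge_atTop 1] with n hn using invRate_pos hn
  filter_upwards [hk.def one_pos, hk1, eventually_ge_atTop 1] with n hkn hkn1 hn
  rw [Real.norm_natCast, Real.norm_natCast, one_mul] at hkn
  have hkn' : k n ≤ n := by exact_mod_cast hkn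
  have hn0 : (0 : ℝ) < n := by exact_mod_cast hn
  have hkr : (1 : ℝ) ≤ k n := by exact_mod_cast hkn1
  refine le_iInf fun g => ?_
  refine le_trans (ENNReal.ofReal_le_ofReal ?_)
    (lpDist_le_iSup_risk (by linarith) hr (hξ n) g (measurable_comb L n (k n)) (measurable_cells _)
      (comb_mem_boundedSteps hL hn hkn') (combMean_mem_boundedSteps hL hn hkn1)
      (funext fun i => by rw [cellMean_comb, cellMean_cells])
      (by positivity) (le_lpDist_comb hL hp0 hn hkn'))
  rw [← inv_invRate hp0, max_eq_left hp.le]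
  have h1 : (1 / 3 : ℝ) * ((2 * k n + 1 : ℝ) / n) ^ (1 / p) ≤ ((k n : ℝ) / n) ^ (1 / p) := by
    calc (1 / 3 : ℝ) * ((2 * k n + 1 : ℝ) / n) ^ (1 / p)
        ≤ (1 / 3 : ℝ) ^ (1 / p) * ((2 * k n + 1 : ℝ) / n) ^ (1 / p) := by
          gcongr
          calc (1 / 3 : ℝ) = (1 / 3) ^ (1 : ℝ) := (Real.rpow_one _).symm
            _ ≤ _ := Real.rpow_le_rpow_of_exponent_ge (by norm_num) (by norm_num)
                (by rw [div_le_one hp0]; linarith)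
      _ = (1 / 3 * ((2 * k n + 1 : ℝ) / n)) ^ (1 / p) :=
          (Real.mul_rpow (by norm_num) (by positivity)).symm
      _ ≤ _ := by
          refine Real.rpow_le_rpow (by positivity) ?_ (by positivity)
          rw [← mul_div_assoc]
          gcongr
          linarith
  have h2 : (0 : ℝ) ≤ L / 4 * (1 / 2) ^ (1 / r) := by positivity
  nlinarith [mul_le_mul_of_nonneg_left h1 h2]

end Lower

end Segmentation

theorem theorem1 {Ω : Type*} [MeasurableSpace Ω] (P : Measure Ω) [IsProbabilityMeasure P]
    (σ : ℝ) (hσ : 0 < σ) (ξ : (n : ℕ) → Fin n → Ω → ℝ) (hξ : Segmentation.IsNoise P σ ξ)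
    (p r L : ℝ) (hp : 0 < p) (hr : 0 < r) (hL : 0 < L)
    (k : ℕ → ℕ) (hk : (fun n => (k n : ℝ)) =o[atTop] (fun n => (n : ℝ))) :
    (∀ (c δ a : ℝ), 1 < c → 0 < δ → δ + σ * √(2 * r + 4) < a →
      ∀ (S : ℕ → Set (ℝ × ℝ)) (s : (n : ℕ) → Ω → (Fin n → ℝ) → (ℝ → ℝ) → ℝ × ℝ → ℝ)
        (fhat : (n : ℕ) → Ω → (Fin n → ℝ) → ℝ → ℝ),
      Segmentation.IsMultiscaleEstimator P c δ (fun n : ℕ => a * √(Real.log n)) S s fhat →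
        limsup (fun n : ℕ => ENNReal.ofReal (1 / √(Real.log n) * Segmentation.invRate p n (k n)) *
            ⨆ f ∈ Segmentation.boundedSteps L (k n),
              Segmentation.risk P p r n (ξ n) (fhat n) f) atTop < ∞ ∧
        ∀ᵐ ω ∂P,
          limsup (fun n : ℕ => ENNReal.ofReal (1 / √(Real.log n) * Segmentation.invRate p n (k n)) *
            ⨆ f ∈ Segmentation.boundedSteps L (k n),
              Segmentation.lpDist p
                (fhat n ω (Segmentation.data n f fun i => ξ n i ω)) f) atTop < ∞) ∧
    (∀ (σ₀ z₀ : ℝ) (φ : (n : ℕ) → Fin n → ℝ → ℝ), 0 < σ₀ → 0 < z₀ →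
      Segmentation.HasNoiseDensity P ξ φ →
      (∀ n i z, |z| ≤ z₀ → Segmentation.ShiftKLLe (φ n i) z (z ^ 2 / σ₀ ^ 2)) →
      (p ≤ 2 ∨ ∀ᶠ n in atTop, 1 ≤ k n) →
        0 < liminf (fun n : ℕ => ENNReal.ofReal (Segmentation.invRate p n (k n)) *
            ⨅ g : Segmentation.Estimator n, ⨆ f ∈ Segmentation.boundedSteps L (k n),
              Segmentation.risk P p r n (ξ n) (fun _ => g.1) f) atTop) := by
  refine ⟨fun c δ a hc hδ ha S s fhat hE => ⟨?_, ?_⟩, fun σ₀ z₀ φ _ hz₀ hd hKL hpk => ?_⟩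
  · exact Segmentation.limsup_risk_lt_top hσ hξ hp hr hL k hc hδ ha hE
  · exact Segmentation.ae_limsup_lt_top hσ hξ hp hr hL k hc hδ ha hE
  · rcases le_or_gt p 2 with hp2 | hp2
    · exact Segmentation.liminf_pos_of_le_two hξ hp hr hL hk hz₀ hd hKL hp2
    · exact Segmentation.liminf_pos_of_two_lt hξ.meas hp2 hr hL hk
        (hpk.resolve_left (not_le.2 hp2))
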